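/- **Notation.** All variables $z,\sigma_0,\sigma_1$ are non-zero and lie on the Riemann surface of the logarithm, so that they carry a definite argument, and powers are taken with respect to it. For $\operatorname{Re}(a)>0$ let $$F^{(1)}(z;a;\sigma)=\int_0^{[\pi-\arg\sigma]}\frac{e^{\sigma\tau}\tau^{a-1}}{z-\tau}\,d\tau\qquad(|\arg(\sigma z)|<\pi),$$ where $\int_0^{[\alpha]}$ is the integral along the ray $\arg\tau=\alpha$ from $0$ to $\infty$; elsewhere $F^{(1)}$ is defined by analytic continuation in $(z,\sigma)$. For complex $N_0,N_1$ with $\operatorname{Re}(N_0)>-1$, $\operatorname{Re}(N_1)>-1$, $\operatorname{Re}(N_0+N_1)>-1$ let $$F^{(2)}(z;N_0+1,N_1+1;\sigma_0,\sigma_1)=\int_0^{[\pi-\arg\sigma_0]}\int_0^{[\pi-\arg\sigma_1]}\frac{e^{\sigma_0\tau_0+\sigma_1\tau_1}\tau_0^{N_0}\tau_1^{N_1}}{(z-\tau_0)(\tau_0-\tau_1)}\,d\tau_1\,d\tau_0$$ for $|\arg(\sigma_0z)|<\pi$, $0<\arg\sigma_1-\arg\sigma_0<2\pi$. Let $\mathcal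 D$ be the set of all $(z,\sigma_0,\sigma_1)$ with $$|\arg(\sigma_0z)|<\tfrac{3\pi}{2},\qquad \left|\arg\left(1+\frac{\sigma_1}{\sigma_0}\right)\right|<\pi ,$$ where the second argument is the principal one, so that the condition says that the complex number $1+\sigma_1/\sigma_0$ is not in $(-\infty,0]$. On $\mathcal D$ put $\arg(\sigma_0+\sigma_1)=\arg\sigma_0+\arg(1+\sigma_1/\sigma_0)$. The function ${}_2F_1(1,N_0+1;N_0+N_1+2;1+\sigma_1/\sigma_0)$ is the principal branch (cut $[1,\infty)$) when $0<\arg\sigma_1-\arg\sigma_0<2\pi$. **Statement.** Let $\operatorname{Re}(N_0)>-1$, $\operatorname{Re}(N_1)>-1$ and $\operatorname{Re}(N_0+N_1)>-1$. The functions $F^{(1)}(z;N_0+1;\sigma)$ and $F^{(1)}(z;N_0+N_1+1;\sigma)$ continue analytically to all $z$, $\sigma$ on the Riemann surface of the logarithm. The function $F^{(2)}(z;N_0+1,N_1+1;\sigma_0,\sigma_1)$ continues analytically to $\mathcal D$ (from the part of $\mathcal D$ on which $|\arg(\sigma_0z)|<\pi$, $0<\arg\sigma_1-\arg\sigma_0<2\pi$),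 and ${}_2F_1(1,N_0+1;N_0+N_1+2;1+s)$ continues analytically, as a function of $s$ on the Riemann surface of the logarithm, to $|\arg(1+s)|<\pi$. With these continuations, for all $(z,\sigma_0,\sigma_1)\in\mathcal D$, $$\begin{aligned}F^{(2)}(z;N_0+1,N_1+1;\sigma_0,\sigma_1)=&-\frac{(\sigma_0+\sigma_1)^{N_0+N_1+1}}{\sigma_0^{N_0+1}\sigma_1^{N_1}}\frac{\Gamma(N_0+1)\Gamma(N_1+1)}{\Gamma(N_0+N_1+2)}\,{}_2F_1\!\left(1,N_0+1;N_0+N_1+2;1+\frac{\sigma_1}{\sigma_0}\right)F^{(1)}(z;N_0+N_1+1;\sigma_0+\sigma_1)\\&-\frac{\Gamma(N_1+1)}{(e^{-\pi i}\sigma_1)^{N_1}}\,e^{(\sigma_0+\sigma_1)z}z^{N_0+N_1}\int_z^\infty e^{-(\sigma_0+\sigma_1)t}\,t^{-N_0-N_1-1}F^{(1)}(t;N_0+1;\sigma_0)\,dt .\end{aligned}$$ Here, for any real $\omega$ with $|\omega+\arg(\sigma_0+\sigma_1)|<\frac{\pi}{2}$, the path of integration runs from $z$ along the circle $|t|=|z|$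 to the point with $\arg t=\omega$ and then along the ray $\arg t=\omega$ to infinity; the integral converges absolutely, and the identity holds for every such $\omega$. -/

import Mathlib

open Complex Set Filter Topology MeasureTheory

/-! Points of the Riemann surface of the logarithm are represented by their logarithms: a complex
number `ζ` stands for the point `exp ζ` with the argument `ζ.im`.  Accordingly the power
`z ^ a` is `exp (a * ζ)`, and multiplication of `z` by `e^{-π i}` is `ζ - π * I`. -/

/-- `g` is the holomorphic continuation to the connected open set `D` of the function `f`, which is
given on the non-empty open subset `U` of `D`. -/
structure IsAnalyticContinuation {E : Type*} [NormedAddCommGroup E] [NormedSpace ℂ E]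
    (f : E → ℂ) (U D : Set E) (g : E → ℂ) : Prop where
  isOpen_base : IsOpen U
  nonempty_base : U.Nonempty
  base_subset : U ⊆ D
  isOpen_domain : IsOpen D
  isPreconnected_domain : IsPreconnected D
  differentiableOn : DifferentiableOn ℂ g D
  eqOn_base : EqOn g f U

/-- A holomorphic continuation is unique on its domain. -/
theorem IsAnalyticContinuation.unique {E : Type*} [NormedAddCommGroup E] [NormedSpace ℂ E]
    {f : E → ℂ} {U D : Set E} {g₁ g₂ : E → ℂ} (h₁ : IsAnalyticContinuation f U D g₁)
    (h₂ : IsAnalyticContinuation f U D g₂) : EqOn g₁ g₂ D := by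
  let S : Set E := {x | ∀ᶠ y in 𝓝 x, g₁ y = g₂ y}
  have hS : IsOpen S := isOpen_setOfPred_eventually_nhds
  have hUS : U ⊆ S := fun x hx => by
    filter_upwards [h₁.isOpen_base.mem_nhds hx] with y hy
    rw [h₁.eqOn_base hy, h₂.eqOn_base hy]
  have key : D ⊆ S := by
    refine h₁.isPreconnected_domain.subset_of_closure_inter_subset hS ?_ ?_
    · obtain ⟨x, hx⟩ := h₁.nonempty_base
      exact ⟨x, h₁.base_subset hx, hUS hx⟩
    · rintro x ⟨hxS, hxD⟩
      obtain ⟨ε, hε, hball⟩ := Metric.isOpen_iff.1 h₁.isOpen_domain x hxD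
      obtain ⟨y, hyS, hxy⟩ := Metric.mem_closure_iff.1 hxS (ε / 2) (by positivity)
      have hsub : Metric.ball y (ε / 2) ⊆ D := by
        refine Subset.trans (fun w hw => ?_) hball
        rw [Metric.mem_ball] at hw ⊢
        have := dist_triangle w y x
        rw [dist_comm] at hxy
        linarith
      have heq : ∀ w ∈ Metric.ball y (ε / 2), g₁ w = g₂ w := by
        intro w hw
        let φ : ℂ → E := fun t => y + t • (w - y)
        have hφ : Differentiable ℂ φ := by fun_prop
        let T : Set ℂ := Metric.ball 0 ((ε / 2) / (‖w - y‖ + (ε / 2 - ‖w - y‖) / 2))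
        have hw' : ‖w - y‖ < ε / 2 := by simpa [dist_eq_norm] using hw
        have hden : 0 < ‖w - y‖ + (ε / 2 - ‖w - y‖) / 2 := by
          have := norm_nonneg (w - y); linarith
        have hT : MapsTo φ T D := by
          intro t ht
          apply hsub
          have ht' : ‖t‖ * (‖w - y‖ + (ε / 2 - ‖w - y‖) / 2) < ε / 2 := by
            rw [← lt_div_iff₀ hden]; simpa [T] using ht
          simp only [φ, Metric.mem_ball, dist_eq_norm, add_sub_cancel_left, norm_smul]
          nlinarith [norm_nonneg t]
        have a₁ : AnalyticOnNhd ℂ (g₁ ∘ φ) T :=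
          (h₁.differentiableOn.comp hφ.differentiableOn hT).analyticOnNhd Metric.isOpen_ball
        have a₂ : AnalyticOnNhd ℂ (g₂ ∘ φ) T :=
          (h₂.differentiableOn.comp hφ.differentiableOn hT).analyticOnNhd Metric.isOpen_ball
        have h0 : (0 : ℂ) ∈ T := Metric.mem_ball_self (by positivity)
        have h1 : (1 : ℂ) ∈ T := by
          simp only [T, Metric.mem_ball, dist_zero_right, norm_one]
          rw [lt_div_iff₀ hden]; linarith
        have hev : g₁ ∘ φ =ᶠ[𝓝 0] g₂ ∘ φ := by
          have hc : Tendsto φ (𝓝 0) (𝓝 y) := by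
            have := hφ.continuous.tendsto 0
            simpa [φ] using this
          exact hc.eventually hyS
        have := a₁.eqOn_of_preconnected_of_eventuallyEq a₂
          (convex_ball (0 : ℂ) _).isPreconnected h0 hev h1
        simpa [φ] using this
      exact Filter.eventually_of_mem (Metric.isOpen_ball.mem_nhds hxy) heq
  exact fun x hx => (key hx).self_of_nhds

/-- The holomorphic continuation to `D` of the function `f` on `U` (a junk function if there is
none; outside `D` its values mean nothing). -/
noncomputable def analyticContinuation {E : Type*} [NormedAddCommGroup E] [NormedSpace ℂ E]
    (f : E → ℂ) (U D : Set E) : E → ℂ :=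
  Classical.epsilon (IsAnalyticContinuation f U D)

/-- `∫ f(log τ) dτ` along the ray from `0` to `∞` on which `arg τ = α`. -/
noncomputable def rayIntegral (α : ℝ) (f : ℂ → ℂ) : ℂ :=
  ∫ r in Ioi (0 : ℝ), f ((Real.log r : ℂ) + (α : ℂ) * I) * exp ((α : ℂ) * I)

/-- The integrand of `∫ f(log t) dt` in the variable `log t`, on the ray `arg t = ω`. -/
noncomputable def logRayIntegrand (f : ℂ → ℂ) (ω : ℝ) (x : ℝ) : ℂ :=
  f ((x : ℂ) + (ω : ℂ) * I) * exp ((x : ℂ) + (ω : ℂ) * I)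

/-- `∫_z^∞ f(log t) dt`, `z = exp ζ`, along the path that runs on the circle `|t| = |z|` from
`arg t = ζ.im` to `arg t = ω` and then on the ray `arg t = ω` to infinity. -/
noncomputable def integralToInfinity (f : ℂ → ℂ) (ζ : ℂ) (ω : ℝ) : ℂ :=
  (∫ θ in ζ.im..ω, f ((ζ.re : ℂ) + (θ : ℂ) * I) * (I * exp ((ζ.re : ℂ) + (θ : ℂ) * I)))
    + ∫ x in Ioi ζ.re, logRayIntegrand f ω x

/-! ### The first hyperterminant -/

/-- The integral `∫ e^{σ τ} τ^{a-1} / (z - τ) dτ` over the ray `arg τ = π - arg σ`, at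
`p = (log z, log σ)`. -/
noncomputable def firstHyperterminantIntegral (a : ℂ) (p : ℂ × ℂ) : ℂ :=
  rayIntegral (Real.pi - p.2.im) fun τ =>
    exp (exp p.2 * exp τ) * exp ((a - 1) * τ) / (exp p.1 - exp τ)

/-- The principal branch `|arg (σ z)| < π`. -/
def firstPrincipalBranch : Set (ℂ × ℂ) := {p | |(p.2 + p.1).im| < Real.pi}

/-- The first hyperterminant `F⁽¹⁾(z; a; σ)`, `ζ = log z`, `l = log σ`, continued analytically from
the principal branch to all `z` and `σ` on the Riemann surface of the logarithm. -/
noncomputable def firstHyperterminant (a ζ l : ℂ) : ℂ :=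
  analyticContinuation (firstHyperterminantIntegral a) firstPrincipalBranch univ (ζ, l)

/-! ### The domain of the parameters -/

/-- The set of `log s` with `|arg (1 + s)| < π`. -/
def ratioDomain : Set ℂ := {l | 1 + exp l ∈ slitPlane}

/-- `log (σ₀ + σ₁)`, with `arg (σ₀ + σ₁) = arg σ₀ + arg (1 + σ₁ / σ₀)` and
`|arg (1 + σ₁ / σ₀)| < π`, as a function of `l₀ = log σ₀` and `l₁ = log σ₁`. -/
noncomputable def logSum (l₀ l₁ : ℂ) : ℂ := l₀ + log (1 + exp (l₁ - l₀))

/-- The set of `(log z, log σ₀, log σ₁)` with `|arg (σ₀ z)| < 3π/2` and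
`|arg (1 + σ₁ / σ₀)| < π`. -/
def secondDomain : Set (ℂ × ℂ × ℂ) :=
  {p | |(p.2.1 + p.1).im| < 3 * Real.pi / 2 ∧ p.2.2 - p.2.1 ∈ ratioDomain}

/-! ### The second hyperterminant -/

/-- The integral `∫ ∫ e^{σ₀ τ₀ + σ₁ τ₁} τ₀^{N₀} τ₁^{N₁} / ((z - τ₀) (τ₀ - τ₁)) dτ₁ dτ₀` over the
rays `arg τ₀ = π - arg σ₀` and `arg τ₁ = π - arg σ₁`, at `p = (log z, log σ₀, log σ₁)`. -/
noncomputable def secondHyperterminantIntegral (N₀ N₁ : ℂ) (p : ℂ × ℂ × ℂ) : ℂ :=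
  rayIntegral (Real.pi - p.2.1.im) fun τ₀ =>
    rayIntegral (Real.pi - p.2.2.im) fun τ₁ =>
      exp (exp p.2.1 * exp τ₀ + exp p.2.2 * exp τ₁) * exp (N₀ * τ₀) * exp (N₁ * τ₁) /
        ((exp p.1 - exp τ₀) * (exp τ₀ - exp τ₁))

/-- The part of the domain that lies in the principal branch `|arg (σ₀ z)| < π`,
`0 < arg σ₁ - arg σ₀ < 2π`. -/
def secondPrincipalBranch : Set (ℂ × ℂ × ℂ) :=
  {p ∈ secondDomain | |(p.2.1 + p.1).im| < Real.pi ∧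
    0 < (p.2.2 - p.2.1).im ∧ (p.2.2 - p.2.1).im < 2 * Real.pi}

/-- The second hyperterminant `F⁽²⁾(z; N₀ + 1, N₁ + 1; σ₀, σ₁)`, `ζ = log z`, `l₀ = log σ₀`,
`l₁ = log σ₁`, continued analytically from the principal branch. -/
noncomputable def secondHyperterminant (N₀ N₁ ζ l₀ l₁ : ℂ) : ℂ :=
  analyticContinuation (secondHyperterminantIntegral N₀ N₁) secondPrincipalBranch secondDomain
    (ζ, l₀, l₁)

/-! ### The hypergeometric function -/

/-- The set of `log s` with `0 < arg s < 2π`, `|1 + s| < 1` and `|arg (1 + s)| < π`; here `₂F₁` at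
`1 + s` is the sum of the hypergeometric series. -/
def hypergeometricBase : Set ℂ :=
  {l ∈ ratioDomain | 0 < l.im ∧ l.im < 2 * Real.pi ∧ ‖1 + exp l‖ < 1}

/-- `₂F₁(a, b; c; 1 + s)` as a function of `l = log s`, continued analytically from the hypergeometric
series.  For `0 < arg s < 2π` this is the principal branch, with the cut `[1, ∞)` of `₂F₁`; the
function is continued across the cut when `arg s` leaves that interval. -/
noncomputable def hypergeometricOneAdd (a b c l : ℂ) : ℂ :=
  analyticContinuation (fun l => ordinaryHypergeometric a b c (1 + exp l)) hypergeometricBase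
    ratioDomain l

/-- `e^{-(σ₀ + σ₁) t} t^{-N₀-N₁-1} F⁽¹⁾(t; N₀ + 1; σ₀)` as a function of `τ = log t`. -/
noncomputable def tailIntegrand (N₀ N₁ l₀ l₁ τ : ℂ) : ℂ :=
  exp (-(exp l₀ + exp l₁) * exp τ) * exp ((-N₀ - N₁ - 1) * τ) * firstHyperterminant (N₀ + 1) τ l₀

/-! Substituting `τ = e^{πi} u / σ` turns every ray into the positive axis. Then F⁽¹⁾ is an
elementary factor times the Stieltjes transform S_a(w) = ∫ e^{-u} u^{a-1} / (e^w + u) du at w =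
log(σz). Likewise F⁽²⁾ is an elementary factor times the Stieltjes transform T of φ(u) = e^{-u}
u^{N₀} S_{N₁+1}(log u + m), taken at w = log(σ₀z) with e^m = -σ₁/σ₀.

The engine is one integration by parts (`hasDerivAt_stieltjes_of_hasDerivAt`): a first-order linear
equation for a kernel in u passes to its Stieltjes transform in w. It gives S_a' = (e^w + a - 1) S_a
- Γ(a). Since the coefficients are entire, this continues S_a to all of ℂ. With y = 1 - e^m = 1 +
σ₁/σ₀ it also gives T' = (y e^w + N₀ + N₁) T - y M - Γ(N₁+1) S_{N₀+1}(w), where M = ∫ φ. The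
function S_{N₀+N₁+1}(w + log y) solves an equation with the same homogeneous part and constant
forcing, so a multiple of it removes the term y M. Variation of constants for the rest produces the
tail integral. The constant of integration is zero because everything decays along the ray Im w =
-arg y (`stieltjes_innerKernel_eq`).

The moment M, as a function of m, satisfies the first-order equation of ₂F₁(1, N₀+1; N₀+N₁+2; y).
Regularity at y = 0 singles out the solution (`eq_ordinaryHypergeometric_of_ode`).

The resulting right-hand side, `scaledSecond`, is holomorphic wherever 1 + σ₁/σ₀ avoids (-∞, 0], so
it supplies the continuation of F⁽²⁾. The tail integral may leave the strip where S_a is given by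
its integral; a rotated representation (`entireStieltjes_eq_rotated`) controls it there and makes
every admissible direction ω give the same value. -/

/-! ### Tools: parameter integrals, first-order linear equations, primitives on left-closed domains
-/

/-- Differentiation under the integral sign for a holomorphic integrand with an integrable bound. -/
theorem hasDerivAt_integral_of_differentiableOn_of_norm_le {α : Type*} [MeasurableSpace α]
    {μ : Measure α} {f : ℂ → α → ℂ} {U : Set ℂ} {z₀ : ℂ} {b : α → ℝ} (hU : U ∈ 𝓝 z₀)
    (hmeas : ∀ z ∈ U, AEStronglyMeasurable (f z) μ)
    (hdiff : ∀ᵐ t ∂μ, DifferentiableOn ℂ (fun z => f z t) U)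
    (hb : ∀ᵐ t ∂μ, ∀ z ∈ U, ‖f z t‖ ≤ b t) (hbi : Integrable b μ) :
    Integrable (fun t => deriv (fun z => f z t) z₀) μ ∧
      HasDerivAt (fun z => ∫ t, f z t ∂μ) (∫ t, deriv (fun z => f z t) z₀ ∂μ) z₀ := by
  obtain ⟨r, hr, hball⟩ := Metric.mem_nhds_iff.1 hU
  have hz₀ : z₀ ∈ U := mem_of_mem_nhds hU
  have hdz : ∀ᵐ t ∂μ, HasDerivAt (fun z => f z t) (deriv (fun z => f z t) z₀) z₀ := by
    filter_upwards [hdiff] with t ht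
    exact (ht.differentiableAt hU).hasDerivAt
  have hm' : AEStronglyMeasurable (fun t => deriv (fun z => f z t) z₀) μ := by
    -- The derivative is measurable as a limit of difference quotients along a null sequence that
    -- stays in the ball.
    let s : ℕ → ℂ := fun k => ((r / 2 / (k + 1) : ℝ) : ℂ)
    have hs0 : ∀ k, s k ≠ 0 := fun k => by
      simp only [s]; exact_mod_cast (by positivity : (r / 2 / ((k : ℝ) + 1)) ≠ 0)
    have hs : Tendsto s atTop (𝓝 0) := by
      have h1 := (tendsto_one_div_add_atTop_nhds_zero_nat (𝕜 := ℝ)).const_mul (r / 2)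
      have h2 := (Complex.continuous_ofReal.tendsto _).comp h1
      simp only [mul_zero, ofReal_zero] at h2
      refine h2.congr fun k => ?_
      simp only [Function.comp, s]; push_cast; ring
    have hsU : ∀ k, z₀ + s k ∈ U := fun k => hball <| by
      simp only [Metric.mem_ball, dist_eq_norm, add_sub_cancel_left, s, norm_real, Real.norm_eq_abs]
      rw [abs_of_pos (by positivity)]
      have : r / 2 / ((k : ℝ) + 1) ≤ r / 2 :=
        div_le_self (by positivity) (by linarith [(Nat.cast_nonneg k : (0 : ℝ) ≤ k)])
      linarith
    refine aestronglyMeasurable_of_tendsto_ae (u := atTop)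
      (f := fun k t => (s k)⁻¹ • (f (z₀ + s k) t - f z₀ t))
      (fun k => (((hmeas _ (hsU k)).sub (hmeas _ hz₀)).const_smul (s k)⁻¹)) ?_
    filter_upwards [hdz] with t ht
    have := hasDerivAt_iff_tendsto_slope_zero.1 ht
    refine this.comp ?_
    exact tendsto_nhdsWithin_iff.2 ⟨hs, Eventually.of_forall fun k => hs0 k⟩
  have hi0 : Integrable (f z₀) μ :=
    hbi.mono' (hmeas _ hz₀) (by filter_upwards [hb] with t ht using ht z₀ hz₀)
  -- The Lipschitz constant is Cauchy's estimate on circles of radius `r / 2` centred in the ball of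
  -- radius `r / 2`.
  have hbi' : Integrable (fun t => b t / (r / 2)) μ := hbi.div_const _
  refine hasDerivAt_integral_of_dominated_loc_of_lip (Metric.ball_mem_nhds z₀ (half_pos hr))
    (Filter.eventually_of_mem hU hmeas) hi0 hm' ?_ hbi' hdz
  filter_upwards [hdiff, hb] with t ht hbt
  refine (convex_ball _ _).lipschitzOnWith_of_nnnorm_deriv_le (𝕜 := ℂ) (fun z hz => ?_)
    (fun z hz => ?_)
  · refine ht.differentiableAt (Filter.mem_of_superset (Metric.isOpen_ball.mem_nhds ?_) hball)
    exact Metric.ball_subset_ball (by linarith) hz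
  · have hsub : Metric.closedBall z (r / 2) ⊆ U := fun w hw => hball <| by
      rw [Metric.mem_closedBall] at hw
      rw [Metric.mem_ball] at hz ⊢
      linarith [dist_triangle w z z₀]
    rw [← NNReal.coe_le_coe, coe_nnnorm, Real.coe_nnabs]
    refine le_trans ?_ (le_abs_self _)
    refine norm_deriv_le_of_forall_mem_sphere_norm_le (half_pos hr) ?_
      (fun w hw => hbt w (hsub (Metric.sphere_subset_closedBall hw)))
    refine (ht.mono ?_).diffContOnCl
    rw [closure_ball _ (half_pos hr).ne']
    exact hsub

/-- A function holomorphic in the first variable, with a jointly continuous partial derivative, and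
differentiable in the second variable at a point, is differentiable at that point. -/
theorem differentiableAt_of_partial {f : ℂ → ℂ → ℂ} {f₁ : ℂ × ℂ → ℂ} {p : ℂ × ℂ}
    (h₁ : ∀ᶠ q in 𝓝 p, HasDerivAt (fun w => f w q.2) (f₁ q) q.1) (hc : ContinuousAt f₁ p)
    (h₂ : DifferentiableAt ℂ (f p.1) p.2) : DifferentiableAt ℂ (fun q : ℂ × ℂ => f q.1 q.2) p := by
  -- Mean value inequality in the first variable with the second held at `q.2`; continuity of the
  -- partial derivative makes the bound uniform.
  have key : (fun q : ℂ × ℂ => f q.1 q.2 - f p.1 q.2 - f₁ p * (q.1 - p.1)) =o[𝓝 p]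
      fun q => q - p := by
    rw [Asymptotics.isLittleO_iff]
    intro ε hε
    have hc' : ∀ᶠ q in 𝓝 p, ‖f₁ q - f₁ p‖ ≤ ε := by
      filter_upwards [Metric.tendsto_nhds.1 hc ε hε] with q hq
      rw [dist_eq_norm] at hq
      exact hq.le
    obtain ⟨r, hr, hball⟩ := Metric.eventually_nhds_iff_ball.1 (h₁.and hc')
    filter_upwards [Metric.ball_mem_nhds p hr] with q hq
    rw [← ball_prod_same] at hq
    have hmem : ∀ w ∈ Metric.ball p.1 r, (w, q.2) ∈ Metric.ball p r := fun w hw => by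
      rw [← ball_prod_same]; exact ⟨hw, hq.2⟩
    have := (convex_ball p.1 r).norm_image_sub_le_of_norm_hasDerivWithin_le
      (f := fun w => f w q.2 - f₁ p * w) (f' := fun w => f₁ (w, q.2) - f₁ p) (C := ε)
      (fun w hw => (((hball _ (hmem w hw)).1).sub
        (by simpa using (hasDerivAt_id w).const_mul (f₁ p))).hasDerivWithinAt)
      (fun w hw => (hball _ (hmem w hw)).2) (Metric.mem_ball_self hr) hq.1
    refine (le_of_eq ?_).trans (this.trans (mul_le_mul_of_nonneg_left (norm_fst_le (q - p)) hε.le))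
    congr 1; ring
  have e2 : (fun q : ℂ × ℂ => f p.1 q.2 - f p.1 p.2 - (fderiv ℂ (f p.1) p.2) (q.2 - p.2))
      =o[𝓝 p] fun q => q - p :=
    (h₂.hasFDerivAt.isLittleO.comp_tendsto (continuous_snd.tendsto p)).trans_isBigO
      (Asymptotics.IsBigO.of_bound 1 (Eventually.of_forall fun q => by
        simpa using (norm_snd_le (q - p))))
  have hd : HasFDerivAt (fun q : ℂ × ℂ => f q.1 q.2)
      ((ContinuousLinearMap.toSpanSingleton ℂ (f₁ p)).coprod (fderiv ℂ (f p.1) p.2)) p := by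
    rw [hasFDerivAt_iff_isLittleO]
    refine (key.add e2).congr_left fun q => ?_
    simp only [ContinuousLinearMap.coprod_apply, Prod.fst_sub, Prod.snd_sub,
      ContinuousLinearMap.toSpanSingleton_apply, smul_eq_mul]
    ring
  exact hd.differentiableAt

/-- Two solutions of the same linear differential equation on a connected open set differ by a
multiple of the solution of the homogeneous equation. -/
theorem exists_sub_eq_mul_exp {D : Set ℂ} (hD : IsOpen D) (hc : IsPreconnected D)
    {g₁ g₂ A A' r : ℂ → ℂ} (hA : ∀ w ∈ D, HasDerivAt A (A' w) w)
    (h₁ : ∀ w ∈ D, HasDerivAt g₁ (A' w * g₁ w + r w) w)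
    (h₂ : ∀ w ∈ D, HasDerivAt g₂ (A' w * g₂ w + r w) w) :
    ∃ κ, ∀ w ∈ D, g₁ w - g₂ w = κ * exp (A w) := by
  have hd : ∀ w ∈ D, HasDerivAt (fun w => exp (-A w) * (g₁ w - g₂ w)) 0 w := fun w hw => by
    refine (((hA w hw).neg.cexp).mul ((h₁ w hw).sub (h₂ w hw))).congr_deriv ?_
    simp only [Pi.sub_apply, Pi.neg_apply]
    ring
  obtain ⟨κ, hκ⟩ := hD.exists_is_const_of_deriv_eq_zero hc
    (fun w hw => (hd w hw).differentiableAt.differentiableWithinAt) (fun w hw => (hd w hw).deriv)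
  refine ⟨κ, fun w hw => ?_⟩
  rw [← hκ w hw, mul_right_comm, ← exp_add, neg_add_cancel, exp_zero, one_mul]

/-- Solutions of the same linear differential equation that agree at a point agree. -/
theorem eqOn_of_linear_ode {D : Set ℂ} (hD : IsOpen D) (hc : IsPreconnected D)
    {g₁ g₂ A A' r : ℂ → ℂ} (hA : ∀ w ∈ D, HasDerivAt A (A' w) w)
    (h₁ : ∀ w ∈ D, HasDerivAt g₁ (A' w * g₁ w + r w) w)
    (h₂ : ∀ w ∈ D, HasDerivAt g₂ (A' w * g₂ w + r w) w) {w₀ : ℂ} (hw₀ : w₀ ∈ D)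
    (h₀ : g₁ w₀ = g₂ w₀) : EqOn g₁ g₂ D := by
  obtain ⟨κ, hκ⟩ := exists_sub_eq_mul_exp hD hc hA h₁ h₂
  have hk : κ = 0 := by
    have := hκ w₀ hw₀
    rw [h₀, sub_self, eq_comm, mul_eq_zero] at this
    exact this.resolve_right (exp_ne_zero _)
  intro w hw
  have := hκ w hw
  rwa [hk, zero_mul, sub_eq_zero] at this

/-- The translates to the left of a disc form a convex open set. -/
theorem exists_halfStrip_subset {D : Set ℂ} (hD : IsOpen D)
    (hl : ∀ z ∈ D, ∀ t : ℝ, 0 ≤ t → z - t ∈ D) {z : ℂ} (hz : z ∈ D) :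
    ∃ V : Set ℂ, IsOpen V ∧ Convex ℝ V ∧ z ∈ V ∧ V ⊆ D ∧ ∀ w ∈ V, ∀ t : ℝ, 0 ≤ t → w - t ∈ V := by
  obtain ⟨ε, hε, hb⟩ := Metric.isOpen_iff.1 hD z hz
  refine ⟨Iio (z.re + ε / 2) ×ℂ Ioo (z.im - ε / 2) (z.im + ε / 2),
    isOpen_Iio.reProdIm isOpen_Ioo, 
    ((convex_Iio _).linear_preimage reLm).inter ((convex_Ioo _ _).linear_preimage imLm),
    ?_, ?_, ?_⟩
  · simp only [mem_reProdIm, mem_Iio, mem_Ioo]; refine ⟨?_, ?_, ?_⟩ <;> linarith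
  · rintro w ⟨h1, h2⟩
    simp only [mem_preimage, mem_Iio, mem_Ioo] at h1 h2
    have hx : (⟨max w.re z.re, w.im⟩ : ℂ) ∈ D := hb <| by
      rw [Metric.mem_ball, dist_eq_norm]
      refine (norm_le_abs_re_add_abs_im _).trans_lt ?_
      simp only [sub_re, sub_im]
      have : |max w.re z.re - z.re| < ε / 2 := by
        rw [abs_of_nonneg (by linarith [le_max_right w.re z.re])]
        rcases max_cases w.re z.re with h | h <;> linarith
      have : |w.im - z.im| < ε / 2 := abs_lt.2 ⟨by linarith, by linarith⟩
      linarith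
    have := hl _ hx (max w.re z.re - w.re) (by linarith [le_max_left w.re z.re])
    convert this using 1
    apply Complex.ext <;> simp
  · rintro w ⟨h1, h2⟩ t ht
    simp only [mem_preimage, mem_Iio, mem_Ioo] at h1 h2
    simp only [mem_reProdIm, mem_Iio, mem_Ioo, sub_re, ofReal_re, sub_im, ofReal_im, sub_zero]
    exact ⟨by linarith, h2⟩

/-- A left-closed set is preconnected if its part in the left half-plane is. -/
theorem isPreconnected_of_sub_mem {D : Set ℂ} (hl : ∀ z ∈ D, ∀ t : ℝ, 0 ≤ t → z - t ∈ D)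
    (hc : IsPreconnected (D ∩ {z | z.re < 0})) : IsPreconnected D := by
  rcases D.eq_empty_or_nonempty with rfl | ⟨z₀, hz₀⟩
  · exact isPreconnected_empty
  have hmem : ∀ z ∈ D, z - ((max z.re 0 + 1 : ℝ) : ℂ) ∈ D ∩ {z | z.re < 0} := fun z hz =>
    ⟨hl z hz _ (by positivity), by
      simp only [mem_ofPred_eq, sub_re, ofReal_re]; linarith [le_max_left z.re 0]⟩
  refine isPreconnected_of_forall (z₀ - ((max z₀.re 0 + 1 : ℝ) : ℂ)) fun z hz => ?_
  refine ⟨(D ∩ {z | z.re < 0}) ∪ segment ℝ z (z - ((max z.re 0 + 1 : ℝ) : ℂ)), ?_,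
    Or.inl (hmem z₀ hz₀), Or.inr (left_mem_segment _ _ _), ?_⟩
  · refine union_subset inter_subset_left ?_
    rintro w ⟨a, b, ha, hb, hab, rfl⟩
    convert hl z hz (b * (max z.re 0 + 1)) (by positivity) using 1
    have : (a : ℂ) = 1 - b := by rw [eq_sub_iff_add_eq]; exact_mod_cast hab
    simp only [real_smul, this]; push_cast; ring
  · exact IsPreconnected.union _ (hmem z hz) (right_mem_segment _ _ _) hc
      (convex_segment _ _).isPreconnected

/-- A holomorphic function on a left-closed open set containing the left half-plane has a primitive. -/
theorem exists_primitive_of_sub_mem {D : Set ℂ} (hD : IsOpen D)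
    (hl : ∀ z ∈ D, ∀ t : ℝ, 0 ≤ t → z - t ∈ D) (hH : {z : ℂ | z.re < 0} ⊆ D) {p : ℂ → ℂ}
    (hp : DifferentiableOn ℂ p D) : ∃ P : ℂ → ℂ, ∀ z ∈ D, HasDerivAt P (p z) z := by
  have prim : ∀ V : Set ℂ, IsOpen V → Convex ℝ V → V ⊆ D →
      ∃ Q : ℂ → ℂ, ∀ z ∈ V, HasDerivAt Q (p z) z := fun V hV hVc hVD => by
    obtain ⟨Q, hQ⟩ := hVc.exists_forall_hasDerivWithinAt (hp.mono hVD)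
    exact ⟨Q, fun z hz => (hQ z hz).hasDerivAt (hV.mem_nhds hz)⟩
  have eqC : ∀ (V : Set ℂ) (Q₁ Q₂ : ℂ → ℂ), IsOpen V → Convex ℝ V →
      (∀ z ∈ V, HasDerivAt Q₁ (p z) z) → (∀ z ∈ V, HasDerivAt Q₂ (p z) z) →
      ∃ κ, ∀ z ∈ V, Q₁ z - Q₂ z = κ := fun V Q₁ Q₂ hV hVc h₁ h₂ => by
    -- With zero coefficient the homogeneous solution is `exp 0 = 1`, so the two primitives differ
    -- by a constant.
    obtain ⟨κ, hκ⟩ := exists_sub_eq_mul_exp hV hVc.isPreconnected (A := 0) (A' := 0) (r := p)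
      (fun w _ => hasDerivAt_const w _) (fun z hz => by simpa using h₁ z hz)
      (fun z hz => by simpa using h₂ z hz)
    exact ⟨κ, by simpa using hκ⟩
  have hHo : IsOpen {z : ℂ | z.re < 0} := isOpen_lt continuous_re continuous_const
  have hHc : Convex ℝ {z : ℂ | z.re < 0} := convex_halfSpace_re_lt 0
  obtain ⟨P₀, hP₀⟩ := prim _ hHo hHc hH
  -- Each local primitive is normalized to equal `P₀` on the left half-plane. This makes the local
  -- choices compatible.
  have loc : ∀ z ∈ D, ∃ (V : Set ℂ) (Q : ℂ → ℂ), IsOpen V ∧ Convex ℝ V ∧ z ∈ V ∧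
      (∀ w ∈ V, ∀ t : ℝ, 0 ≤ t → w - t ∈ V) ∧ (∀ w ∈ V, HasDerivAt Q (p w) w) ∧
      ∀ w ∈ V, w.re < 0 → Q w = P₀ w := fun z hz => by
    obtain ⟨V, hV, hVc, hzV, hVD, hVl⟩ := exists_halfStrip_subset hD hl hz
    obtain ⟨Q, hQ⟩ := prim V hV hVc hVD
    obtain ⟨κ, hκ⟩ := eqC (V ∩ {z | z.re < 0}) Q P₀ (hV.inter hHo) (hVc.inter hHc)
      (fun w hw => hQ w hw.1) (fun w hw => hP₀ w hw.2)
    refine ⟨V, fun w => Q w - κ, hV, hVc, hzV, hVl, fun w hw => (hQ w hw).sub_const κ,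
      fun w hw hw0 => ?_⟩
    have := hκ w ⟨hw, hw0⟩
    linear_combination this
  choose! V Q hV hVc hzV hVl hQ hQP using loc
  refine ⟨fun z => Q z z, fun z hz => (hQ z hz z (hzV z hz)).congr_of_eventuallyEq ?_⟩
  filter_upwards [(hV z hz).mem_nhds (hzV z hz), hD.mem_nhds hz] with w hw hwD
  obtain ⟨κ, hκ⟩ := eqC (V w ∩ V z) (Q w) (Q z) ((hV w hwD).inter (hV z hz))
    ((hVc w hwD).inter (hVc z hz)) (fun x hx => hQ w hwD x hx.1) (fun x hx => hQ z hz x hx.2)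
  -- Two local primitives differ by a constant on the convex overlap. Moving far enough to the left
  -- stays in the overlap and reaches the half-plane, where both equal `P₀`.
  have h1 : w - ((max w.re 0 + 1 : ℝ) : ℂ) ∈ V w ∩ V z :=
    ⟨hVl w hwD w (hzV w hwD) _ (by positivity), hVl z hz w hw _ (by positivity)⟩
  have h2 : (w - ((max w.re 0 + 1 : ℝ) : ℂ)).re < 0 := by
    simp only [sub_re, ofReal_re]; linarith [le_max_left w.re 0]
  have h3 := hκ _ h1
  rw [hQP w hwD _ h1.1 h2, hQP z hz _ h1.2 h2, sub_self] at h3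
  have h4 := hκ w ⟨hzV w hwD, hw⟩
  rw [← h3] at h4
  exact sub_eq_zero.1 h4

/-! ### Stieltjes transforms in the logarithmic variable -/

/-- The Stieltjes transform of `φ`, as a function of the logarithm of the point. -/
noncomputable def stieltjes (φ : ℝ → ℂ) (w : ℂ) : ℂ :=
  ∫ u in Ioi (0 : ℝ), φ u / (exp w + u)

theorem cos_half_pos {δ : ℝ} (h0 : 0 ≤ δ) (hδ : δ < Real.pi) : 0 < Real.cos (δ / 2) :=
  Real.cos_pos_of_mem_Ioo ⟨by linarith [Real.pi_pos], by linarith⟩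

/-- With r = |e^w| and θ = Im w, |e^w + u|² = (r + u)² - 4ru sin²(θ/2), and 4ru ≤ (r + u)² leaves (r
+ u)² cos²(θ/2). -/
theorem cos_half_mul_le_norm_exp_add {w : ℂ} {δ u : ℝ} (hw : |w.im| ≤ δ) (hδ : δ < Real.pi) :
    Real.cos (δ / 2) * (Real.exp w.re + u) ≤ ‖exp w + u‖ := by
  have hd0 : 0 ≤ δ := (abs_nonneg _).trans hw
  have hc : Real.cos (δ / 2) ≤ Real.cos (w.im / 2) := by
    rw [← Real.cos_abs (w.im / 2), abs_div, abs_of_pos (zero_lt_two' ℝ)]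
    exact Real.cos_le_cos_of_nonneg_of_le_pi (by positivity) (by linarith) (by linarith)
  have hc0 := cos_half_pos hd0 hδ
  set r := Real.exp w.re with hr
  have hr0 : 0 < r := Real.exp_pos _
  refine abs_le_of_sq_le_sq' ?_ (norm_nonneg _) |>.2
  rw [Complex.sq_norm, Complex.normSq_apply]
  simp only [add_re, exp_re, ofReal_re, add_im, exp_im, ofReal_im, add_zero, ← hr]
  have h1 := Real.cos_sq' w.im
  have h2 := Real.cos_sq (w.im / 2)
  rw [mul_div_cancel₀ _ (two_ne_zero' ℝ)] at h2
  have h3 : Real.cos (δ / 2) ^ 2 ≤ Real.cos (w.im / 2) ^ 2 := by gcongr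
  have h4 : Real.cos (w.im / 2) ^ 2 ≤ 1 := Real.cos_sq_le_one _
  have e : (r * Real.cos w.im + u) * (r * Real.cos w.im + u) +
      r * Real.sin w.im * (r * Real.sin w.im) =
      (r + u) ^ 2 - 4 * r * u * (1 - Real.cos (w.im / 2) ^ 2) := by
    have : Real.cos w.im = 2 * Real.cos (w.im / 2) ^ 2 - 1 := by linarith
    have h5 := Real.sin_sq_add_cos_sq w.im
    linear_combination r ^ 2 * h5 + 2 * r * u * this
  rw [e, mul_pow]
  nlinarith [mul_nonneg (sq_nonneg (r - u)) (sub_nonneg.2 h4),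
    mul_nonneg (sq_nonneg (r + u)) (sub_nonneg.2 h3)]

theorem exp_add_ne_zero {w : ℂ} {u : ℝ} (hw : |w.im| < Real.pi) (hu : 0 ≤ u) :
    exp w + u ≠ 0 := by
  have h := cos_half_mul_le_norm_exp_add (u := u) le_rfl hw
  have h2 := cos_half_pos (abs_nonneg w.im) hw
  have : 0 < ‖exp w + u‖ := lt_of_lt_of_le (by positivity) h
  exact norm_pos_iff.1 this

theorem norm_div_exp_add_le {w : ℂ} {δ u : ℝ} (hw : |w.im| ≤ δ) (hδ : δ < Real.pi)
    (hu : 0 ≤ u) (a : ℂ) :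
    ‖a / (exp w + u)‖ ≤ ‖a‖ * (Real.cos (δ / 2) * Real.exp w.re)⁻¹ := by
  have h2 := cos_half_pos ((abs_nonneg w.im).trans hw) hδ
  rw [norm_div, div_eq_mul_inv]
  gcongr
  exact le_trans (by gcongr; linarith) (cos_half_mul_le_norm_exp_add hw hδ)

theorem continuousOn_inv_exp_add {w : ℂ} (hw : |w.im| < Real.pi) :
    ContinuousOn (fun u : ℝ => (exp w + u)⁻¹) (Ioi 0) :=
  ContinuousOn.inv₀ (by fun_prop) fun _ hu => exp_add_ne_zero hw (le_of_lt hu)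

theorem aestronglyMeasurable_div_exp_add {φ : ℝ → ℂ}
    (hφ : AEStronglyMeasurable φ (volume.restrict (Ioi 0))) {w : ℂ} (hw : |w.im| < Real.pi) :
    AEStronglyMeasurable (fun u : ℝ => φ u / (exp w + u)) (volume.restrict (Ioi 0)) := by
  simp only [div_eq_mul_inv]
  exact hφ.mul ((continuousOn_inv_exp_add hw).aestronglyMeasurable measurableSet_Ioi)

theorem integrableOn_div_exp_add {φ : ℝ → ℂ} (hφ : IntegrableOn φ (Ioi 0)) {w : ℂ}
    (hw : |w.im| < Real.pi) : IntegrableOn (fun u : ℝ => φ u / (exp w + u)) (Ioi 0) := by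
  refine (hφ.norm.mul_const (Real.cos (|w.im| / 2) * Real.exp w.re)⁻¹).mono'
    (aestronglyMeasurable_div_exp_add hφ.1 hw)
    ((ae_restrict_iff' measurableSet_Ioi).2 (Eventually.of_forall fun u hu => ?_))
  exact norm_div_exp_add_le le_rfl hw (le_of_lt hu) _

theorem norm_stieltjes_le {φ : ℝ → ℂ} (hφ : IntegrableOn φ (Ioi 0)) {w : ℂ} {δ : ℝ}
    (hw : |w.im| ≤ δ) (hδ : δ < Real.pi) :
    ‖stieltjes φ w‖ ≤
      (∫ u in Ioi (0 : ℝ), ‖φ u‖) * (Real.cos (δ / 2))⁻¹ * Real.exp (-w.re) := by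
  refine (norm_integral_le_of_norm_le (hφ.norm.mul_const (Real.cos (δ / 2) * Real.exp w.re)⁻¹)
    ((ae_restrict_iff' measurableSet_Ioi).2 (Eventually.of_forall fun u hu =>
      norm_div_exp_add_le hw hδ (le_of_lt hu) _))).trans (le_of_eq ?_)
  rw [integral_mul_const, mul_inv, Real.exp_neg, mul_assoc]

/-- The horizontal open strip of half-width `π`. -/
theorem isOpen_strip (β r : ℝ) : IsOpen {w : ℂ | |w.im - β| < r} :=
  isOpen_lt (by fun_prop) continuous_const

theorem convex_strip (β r : ℝ) : Convex ℝ {w : ℂ | |w.im - β| < r} := by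
  have : {w : ℂ | |w.im - β| < r} = imLm ⁻¹' Metric.ball β r := by
    ext w; simp [Real.dist_eq]
  rw [this]
  exact (convex_ball β r).linear_preimage imLm

/-- The integrability of the differentiated integrand is recorded as well, since the integration by
parts below splits an integral containing it. -/
theorem hasDerivAt_stieltjes {φ : ℝ → ℂ} (hφ : IntegrableOn φ (Ioi 0)) {w : ℂ}
    (hw : |w.im| < Real.pi) :
    IntegrableOn (fun u : ℝ => -(φ u * exp w) / (exp w + u) ^ 2) (Ioi 0) ∧
    HasDerivAt (stieltjes φ) (∫ u in Ioi (0 : ℝ), -(φ u * exp w) / (exp w + u) ^ 2) w := by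
  obtain ⟨δ, hδ1, hδ⟩ := exists_between hw
  have hd0 : 0 ≤ δ := (abs_nonneg _).trans hδ1.le
  have hc := cos_half_pos hd0 hδ
  let U : Set ℂ := {z | |z.im| < δ ∧ w.re - 1 < z.re}
  have hUo : IsOpen U := (isOpen_lt (f := fun z : ℂ => |z.im|) (by fun_prop) continuous_const).inter
    (isOpen_lt (f := fun _ : ℂ => w.re - 1) continuous_const continuous_re)
  have hU : U ∈ 𝓝 w := hUo.mem_nhds ⟨hδ1, by linarith⟩
  have hder : ∀ u ∈ Ioi (0 : ℝ), ∀ z : ℂ, |z.im| < Real.pi →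
      HasDerivAt (fun z => φ u / (exp z + u)) (-(φ u * exp z) / (exp z + u) ^ 2) z := by
    intro u hu z hz
    have h := (hasDerivAt_const z (φ u)).div ((hasDerivAt_exp z).add_const (u : ℂ))
      (exp_add_ne_zero hz (le_of_lt hu))
    simpa using! h
  have key := hasDerivAt_integral_of_differentiableOn_of_norm_le (μ := volume.restrict (Ioi 0))
    (f := fun z (u : ℝ) => φ u / (exp z + u)) hU
    (b := fun u => ‖φ u‖ * (Real.cos (δ / 2) * Real.exp (w.re - 1))⁻¹)
    (fun z hz => aestronglyMeasurable_div_exp_add hφ.1 (hz.1.trans hδ))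
    ((ae_restrict_iff' measurableSet_Ioi).2 (Eventually.of_forall fun u hu z hz =>
      (hder u hu z (hz.1.trans hδ)).differentiableAt.differentiableWithinAt))
    ((ae_restrict_iff' measurableSet_Ioi).2 (Eventually.of_forall fun u hu z hz => by
      refine (norm_div_exp_add_le hz.1.le hδ (le_of_lt hu) _).trans ?_
      have := hz.2.le
      gcongr))
    (hφ.norm.mul_const _)
  have e : EqOn (fun u : ℝ => deriv (fun z => φ u / (exp z + u)) w)
      (fun u : ℝ => -(φ u * exp w) / (exp w + u) ^ 2) (Ioi 0) :=
    fun u hu => (hder u hu w hw).deriv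
  refine ⟨(integrableOn_congr_fun e measurableSet_Ioi).1 key.1, ?_⟩
  rw [← setIntegral_congr_fun measurableSet_Ioi e]
  exact key.2

/-! ### Integration by parts for kernels bounded by a power times an exponential -/

section PowerExp

variable {φ : ℝ → ℂ} {C p q : ℝ}

theorem integrableOn_rpow_mul_exp_neg (hp : 0 < p) (hq : 0 < q) :
    IntegrableOn (fun u : ℝ => u ^ (p - 1) * Real.exp (-q * u)) (Ioi 0) := by
  have := integrableOn_rpow_mul_exp_neg_mul_rpow (p := 1) (s := p - 1) (b := q) (by linarith)
    one_pos hq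
  simpa using this

theorem integrableOn_of_norm_le_rpow_mul_exp (hp : 0 < p) (hq : 0 < q)
    (hm : ContinuousOn φ (Ioi 0))
    (h : ∀ u > 0, ‖φ u‖ ≤ C * (u ^ (p - 1) * Real.exp (-q * u))) : IntegrableOn φ (Ioi 0) :=
  ((integrableOn_rpow_mul_exp_neg hp hq).const_mul C).mono'
    (hm.aestronglyMeasurable measurableSet_Ioi)
    ((ae_restrict_iff' measurableSet_Ioi).2 (Eventually.of_forall h))

theorem norm_ofReal_mul_le_rpow_mul_exp
    (h : ∀ u > 0, ‖φ u‖ ≤ C * (u ^ (p - 1) * Real.exp (-q * u))) :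
    ∀ u : ℝ, u > 0 → ‖(u : ℂ) * φ u‖ ≤ C * (u ^ (p + 1 - 1) * Real.exp (-q * u)) := fun u hu => by
  rw [norm_mul, norm_real, Real.norm_of_nonneg hu.le, show p + 1 - 1 = 1 + (p - 1) by ring,
    Real.rpow_add hu, Real.rpow_one]
  calc u * ‖φ u‖ ≤ u * (C * (u ^ (p - 1) * Real.exp (-q * u))) := by gcongr; exact h u hu
    _ = _ := by ring

theorem tendsto_ofReal_mul_zero (hp : 0 < p)
    (h : ∀ u > 0, ‖φ u‖ ≤ C * (u ^ (p - 1) * Real.exp (-q * u))) :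
    Tendsto (fun u : ℝ => (u : ℂ) * φ u) (𝓝[>] 0) (𝓝 0) := by
  have h1 : Tendsto (fun u : ℝ => C * (u ^ (p + 1 - 1) * Real.exp (-q * u))) (𝓝[>] 0) (𝓝 0) := by
    have : ContinuousAt (fun u : ℝ => C * (u ^ (p + 1 - 1) * Real.exp (-q * u))) 0 := by
      refine continuousAt_const.mul (ContinuousAt.mul ?_ (by fun_prop))
      exact Real.continuousAt_rpow_const _ _ (Or.inr (by linarith))
    have h2 := this.tendsto.mono_left (nhdsWithin_le_nhds (s := Ioi 0))
    simpa [Real.zero_rpow hp.ne'] using h2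
  refine squeeze_zero_norm' ?_ h1
  filter_upwards [self_mem_nhdsWithin] with u hu using norm_ofReal_mul_le_rpow_mul_exp h u hu

theorem tendsto_atTop_of_norm_le_rpow_mul_exp (hq : 0 < q)
    (h : ∀ u > 0, ‖φ u‖ ≤ C * (u ^ (p - 1) * Real.exp (-q * u))) :
    Tendsto φ atTop (𝓝 0) := by
  have h1 := (tendsto_rpow_mul_exp_neg_mul_atTop_nhds_zero (p - 1) q hq).const_mul C
  rw [mul_zero] at h1
  refine squeeze_zero_norm' ?_ h1
  filter_upwards [Ioi_mem_atTop 0] with u hu using h u hu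

variable {b s : ℂ} {ψ : ℝ → ℂ}

/-- The integral of the derivative of `u φ(u)` vanishes. -/
theorem integral_eq_of_hasDerivAt (hp : 0 < p) (hq : 0 < q)
    (h : ∀ u > 0, ‖φ u‖ ≤ C * (u ^ (p - 1) * Real.exp (-q * u)))
    (hφ : ∀ u > 0, HasDerivAt φ (((-b * u + s) * φ u + ψ u) / u) u)
    (hψ : IntegrableOn ψ (Ioi 0)) :
    (1 + s) * (∫ u in Ioi (0 : ℝ), φ u) - b * (∫ u in Ioi (0 : ℝ), (u : ℂ) * φ u) +
      ∫ u in Ioi (0 : ℝ), ψ u = 0 := by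
  have hφc : ContinuousOn φ (Ioi 0) := fun u hu => (hφ u hu).continuousAt.continuousWithinAt
  have hi := integrableOn_of_norm_le_rpow_mul_exp hp hq hφc h
  have hi1 : IntegrableOn (fun u : ℝ => (u : ℂ) * φ u) (Ioi 0) :=
    integrableOn_of_norm_le_rpow_mul_exp (p := p + 1) (by linarith) hq (by fun_prop)
      (norm_ofReal_mul_le_rpow_mul_exp h)
  have hI := ((hi.const_mul (1 + s)).sub (hi1.const_mul b)).add hψ
  have e : EqOn (fun u : ℝ => (1 : ℂ) * φ u + (u : ℂ) * (((-b * u + s) * φ u + ψ u) / u))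
      (((fun u => (1 + s) * φ u) - fun u : ℝ => b * ((u : ℂ) * φ u)) + ψ) (Ioi 0) := fun u hu => by
    have : (u : ℂ) ≠ 0 := by exact_mod_cast (ne_of_gt hu : u ≠ 0)
    simp only [Pi.add_apply, Pi.sub_apply]
    field_simp
    ring
  -- The factor `u` cancels the division by `u` in the equation for `φ` and removes the boundary
  -- term at 0.
  have key := integral_Ioi_deriv_mul_eq_sub (a := 0) (u := fun u : ℝ => (u : ℂ)) (v := φ)
    (u' := fun _ => 1) (v' := fun u : ℝ => ((-b * u + s) * φ u + ψ u) / u) (a' := 0) (b' := 0)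
    (fun x _ => (hasDerivAt_id x).ofReal_comp) (fun x hx => hφ x hx)
    ((integrableOn_congr_fun e measurableSet_Ioi).2 hI)
    (tendsto_ofReal_mul_zero hp h)
    (tendsto_atTop_of_norm_le_rpow_mul_exp hq (norm_ofReal_mul_le_rpow_mul_exp h))
  rw [setIntegral_congr_fun measurableSet_Ioi e, integral_add' ((hi.const_mul (1 + s)).sub (hi1.const_mul b)) hψ,
    integral_sub' (hi.const_mul (1 + s)) (hi1.const_mul b), integral_const_mul, integral_const_mul] at key
  simpa using key

/-- If `u φ' = (s - b u) φ + ψ`, then the Stieltjes transform of `φ` satisfies a differential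
equation of the same form. -/
theorem hasDerivAt_stieltjes_of_hasDerivAt (hp : 0 < p) (hq : 0 < q)
    (h : ∀ u > 0, ‖φ u‖ ≤ C * (u ^ (p - 1) * Real.exp (-q * u)))
    (hφ : ∀ u > 0, HasDerivAt φ (((-b * u + s) * φ u + ψ u) / u) u)
    (hψ : IntegrableOn ψ (Ioi 0)) {w : ℂ} (hw : |w.im| < Real.pi) :
    HasDerivAt (stieltjes φ) ((b * exp w + s) * stieltjes φ w +
      (-(b * ∫ u in Ioi (0 : ℝ), φ u) + stieltjes ψ w)) w := by
  have hφc : ContinuousOn φ (Ioi 0) := fun u hu => (hφ u hu).continuousAt.continuousWithinAt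
  have hi := integrableOn_of_norm_le_rpow_mul_exp hp hq hφc h
  obtain ⟨hi2, hd⟩ := hasDerivAt_stieltjes hi hw
  have hiS := integrableOn_div_exp_add hi hw
  have hiψ := integrableOn_div_exp_add hψ hw
  have hI := (((hiS.const_mul (b * exp w + s)).sub (hi.const_mul b)).add hiψ).sub hi2
  have hne : ∀ u ∈ Ioi (0 : ℝ), exp w + u ≠ 0 := fun u hu => exp_add_ne_zero hw (le_of_lt hu)
  -- The derivative of u φ(u)/(e^w + u). Writing u/(e^w + u) = 1 - e^w/(e^w + u) separates the
  -- moment of φ from its transform, and the term with the squared denominator is minus the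
  -- w-derivative of the integrand.
  have e : EqOn (fun u : ℝ => exp w / (exp w + u) ^ 2 * φ u +
        (u : ℂ) / (exp w + u) * (((-b * u + s) * φ u + ψ u) / u))
      ((((fun u : ℝ => (b * exp w + s) * (φ u / (exp w + u))) - fun u : ℝ => b * φ u) +
        fun u : ℝ => ψ u / (exp w + u)) - fun u : ℝ => -(φ u * exp w) / (exp w + u) ^ 2)
      (Ioi 0) := fun u hu => by
    have h1 : (u : ℂ) ≠ 0 := by exact_mod_cast (ne_of_gt hu : u ≠ 0)
    have h2 := hne u hu
    simp only [Pi.add_apply, Pi.sub_apply]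
    field_simp
    ring
  have hlim : ∀ l : Filter ℝ, l ≤ 𝓟 (Ioi 0) → Tendsto (fun u : ℝ => (u : ℂ) * φ u) l (𝓝 0) →
      Tendsto ((fun u : ℝ => (u : ℂ) / (exp w + u)) * φ) l (𝓝 0) := fun l hl ht => by
    have := (ht.norm.mul_const (Real.cos (|w.im| / 2) * Real.exp w.re)⁻¹)
    rw [norm_zero, zero_mul] at this
    refine squeeze_zero_norm' ?_ this
    filter_upwards [hl (mem_principal_self _)] with u hu
    have := norm_div_exp_add_le (w := w) le_rfl hw (le_of_lt hu) (u * φ u)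
    rwa [mul_div_right_comm] at this
  have key := integral_Ioi_deriv_mul_eq_sub (a := 0) (u := fun u : ℝ => (u : ℂ) / (exp w + u))
    (v := φ) (u' := fun u : ℝ => exp w / (exp w + u) ^ 2)
    (v' := fun u : ℝ => ((-b * u + s) * φ u + ψ u) / u) (a' := 0) (b' := 0)
    (fun x hx => by
      have h1 := (hasDerivAt_id x).ofReal_comp
      refine (h1.div (h1.const_add (exp w)) (hne x hx)).congr_deriv ?_
      simp) (fun x hx => hφ x hx)
    ((integrableOn_congr_fun e measurableSet_Ioi).2 hI)
    (hlim _ inf_le_right (tendsto_ofReal_mul_zero hp h))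
    (hlim _ (le_principal_iff.2 (Ioi_mem_atTop 0))
      (tendsto_atTop_of_norm_le_rpow_mul_exp hq (norm_ofReal_mul_le_rpow_mul_exp h)))
  rw [setIntegral_congr_fun measurableSet_Ioi e,
    integral_sub' (((hiS.const_mul _).sub (hi.const_mul b)).add hiψ) hi2,
    integral_add' ((hiS.const_mul _).sub (hi.const_mul b)) hiψ,
    integral_sub' (hiS.const_mul _) (hi.const_mul b), integral_const_mul, integral_const_mul,
    sub_zero, sub_eq_zero] at key
  refine hd.congr_deriv ?_
  rw [← key, stieltjes, stieltjes]
  ring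

end PowerExp

/-! ### The Gamma kernel and its entire Stieltjes transform -/

/-- The integrand `e^{-b u} u^{a-1}` of the Gamma integral. -/
noncomputable def gammaKernel (b a : ℂ) (u : ℝ) : ℂ := exp (-b * u) * (u : ℂ) ^ (a - 1)

theorem norm_gammaKernel (b a : ℂ) {u : ℝ} (hu : u > 0) :
    ‖gammaKernel b a u‖ = u ^ (a.re - 1) * Real.exp (-b.re * u) := by
  rw [gammaKernel, norm_mul, norm_cpow_eq_rpow_re_of_pos hu, norm_exp, mul_comm]
  simp

theorem norm_gammaKernel_le (b a : ℂ) (u : ℝ) (hu : u > 0) :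
    ‖gammaKernel b a u‖ ≤ 1 * (u ^ (a.re - 1) * Real.exp (-b.re * u)) := by
  rw [one_mul, norm_gammaKernel b a hu]

theorem hasDerivAt_gammaKernel (b a : ℂ) {u : ℝ} (hu : u > 0) :
    HasDerivAt (gammaKernel b a) ((-b * u + (a - 1)) * gammaKernel b a u / u) u := by
  have h0 : (u : ℂ) ≠ 0 := by exact_mod_cast hu.ne'
  have h1 : HasDerivAt (fun z : ℂ => exp (-b * z) * z ^ (a - 1))
      (exp (-b * u) * (-b * 1) * (u : ℂ) ^ (a - 1) +
        exp (-b * u) * ((a - 1) * (u : ℂ) ^ (a - 1 - 1) * 1)) u :=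
    (((hasDerivAt_id (u : ℂ)).const_mul (-b)).cexp).mul
      ((hasDerivAt_id (u : ℂ)).cpow_const (Or.inl (by simpa using hu)))
  refine h1.comp_ofReal.congr_deriv ?_
  rw [cpow_sub (a - 1) 1 h0, cpow_one, gammaKernel]
  field_simp

theorem hasDerivAt_gammaKernel' (b a : ℂ) (u : ℝ) (hu : u > 0) :
    HasDerivAt (gammaKernel b a) (((-b * u + (a - 1)) * gammaKernel b a u + (fun _ => 0) u) / u) u := by
  simpa using hasDerivAt_gammaKernel b a hu

theorem continuousOn_gammaKernel (b a : ℂ) : ContinuousOn (gammaKernel b a) (Ioi 0) :=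
  fun _ hu => (hasDerivAt_gammaKernel b a hu).continuousAt.continuousWithinAt

theorem integrableOn_gammaKernel {b a : ℂ} (hb : 0 < b.re) (ha : 0 < a.re) :
    IntegrableOn (gammaKernel b a) (Ioi 0) :=
  integrableOn_of_norm_le_rpow_mul_exp ha hb (continuousOn_gammaKernel b a)
    (norm_gammaKernel_le b a)

theorem integral_gammaKernel_one {a : ℂ} (ha : 0 < a.re) :
    ∫ u in Ioi (0 : ℝ), gammaKernel 1 a u = Gamma a := by
  rw [Gamma_eq_integral ha, GammaIntegral]
  refine setIntegral_congr_fun measurableSet_Ioi fun u _ => ?_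
  simp [gammaKernel]

theorem re_exp_pos {z : ℂ} (hz : |z.im| < Real.pi / 2) : 0 < (exp z).re := by
  rw [exp_re]
  exact mul_pos (Real.exp_pos _) (Real.cos_pos_of_mem_Ioo (abs_lt.1 hz))

/-- In place of a contour rotation: both sides solve g' = -a g on the strip and agree at z = 0. The
equation for the integral is the vanishing of ∫ (u · kernel)'. -/
theorem integral_gammaKernel_exp {a z : ℂ} (ha : 0 < a.re) (hz : |z.im| < Real.pi / 2) :
    ∫ u in Ioi (0 : ℝ), gammaKernel (exp z) a u = exp (-a * z) * Gamma a := by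
  have hder : ∀ z ∈ {z : ℂ | |z.im - 0| < Real.pi / 2},
      HasDerivAt (fun z => ∫ u in Ioi (0 : ℝ), gammaKernel (exp z) a u)
        (-a * (∫ u in Ioi (0 : ℝ), gammaKernel (exp z) a u) + 0) z := by
    intro z hz
    simp only [sub_zero, mem_ofPred_eq] at hz
    have hre := re_exp_pos hz
    have hU : {y : ℂ | (exp z).re / 2 < (exp y).re} ∈ 𝓝 z :=
      (isOpen_lt continuous_const (by fun_prop)).mem_nhds (by simp only [mem_ofPred_eq]; linarith)
    have hd : ∀ u : ℝ, ∀ y : ℂ, HasDerivAt (fun y => gammaKernel (exp y) a u)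
        (-(exp y) * (u * gammaKernel (exp y) a u)) y := fun u y => by
      refine ((((hasDerivAt_exp y).neg.mul_const (u : ℂ)).cexp).mul_const
        ((u : ℂ) ^ (a - 1))).congr_deriv ?_
      simp only [gammaKernel, Pi.neg_apply]; ring
    have key := hasDerivAt_integral_of_differentiableOn_of_norm_le
      (μ := volume.restrict (Ioi 0)) (f := fun y (u : ℝ) => gammaKernel (exp y) a u) hU
      (b := fun u => u ^ (a.re - 1) * Real.exp (-((exp z).re / 2) * u))
      (fun y _ => (continuousOn_gammaKernel _ a).aestronglyMeasurable measurableSet_Ioi)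
      (Eventually.of_forall fun u y _ => (hd u y).differentiableAt.differentiableWithinAt)
      ((ae_restrict_iff' measurableSet_Ioi).2 (Eventually.of_forall fun u hu y hy => by
        rw [norm_gammaKernel _ _ hu]
        have h1 : (exp z).re / 2 < (exp y).re := hy
        have h2 : (0 : ℝ) < u := hu
        gcongr))
      (integrableOn_rpow_mul_exp_neg ha (by linarith))
    refine key.2.congr_deriv ?_
    simp only [(hd _ z).deriv]
    have h2 := integral_eq_of_hasDerivAt ha hre (norm_gammaKernel_le _ a)
      (hasDerivAt_gammaKernel' _ a) integrableOn_zero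
    rw [integral_const_mul]
    simp only [integral_zero] at h2
    linear_combination h2
  have hlin : ∀ z : ℂ, HasDerivAt (fun z => -a * z) (-a) z := fun z => by
    simpa using (hasDerivAt_id z).const_mul (-a)
  have key := eqOn_of_linear_ode (isOpen_strip 0 _) (convex_strip 0 _).isPreconnected
    (A := fun z => -a * z) (A' := fun _ => -a) (r := fun _ => 0) (fun z _ => hlin z) hder
    (g₂ := fun z => exp (-a * z) * Gamma a)
    (fun z _ => (((hlin z).cexp).mul_const _).congr_deriv (by ring))
    (w₀ := 0) (by simpa using Real.pi_pos)
    (by simpa using integral_gammaKernel_one ha)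
  exact key (by simpa using hz)

theorem hasDerivAt_stieltjes_gammaKernel {a b w : ℂ} (ha : 0 < a.re) (hb : 0 < b.re)
    (hw : |w.im| < Real.pi) :
    HasDerivAt (stieltjes (gammaKernel b a)) ((b * exp w + (a - 1)) *
      stieltjes (gammaKernel b a) w - b * ∫ u in Ioi (0 : ℝ), gammaKernel b a u) w := by
  refine (hasDerivAt_stieltjes_of_hasDerivAt ha hb (norm_gammaKernel_le b a)
    (hasDerivAt_gammaKernel' b a) integrableOn_zero hw).congr_deriv ?_
  simp [stieltjes, sub_eq_add_neg]

/-- This exponent gives the homogeneous solution of every equation in w below. -/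
theorem hasDerivAt_mul_exp_add (y n w : ℂ) :
    HasDerivAt (fun w => y * exp w + n * w) (y * exp w + n) w := by
  simpa using! ((hasDerivAt_exp w).const_mul y).add ((hasDerivAt_id w).const_mul n)

/-- Variation of constants: the coefficients are entire, so the solution with the right value at 0
is entire, and uniqueness identifies it with the transform on the strip. -/
theorem exists_entire_stieltjes_gammaKernel {a : ℂ} (ha : 0 < a.re) :
    ∃ g : ℂ → ℂ, (∀ w, HasDerivAt g ((exp w + (a - 1)) * g w - Gamma a) w) ∧
      EqOn g (stieltjes (gammaKernel 1 a)) {w | |w.im| < Real.pi} := by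
  let A : ℂ → ℂ := fun w => 1 * exp w + (a - 1) * w
  have hA : ∀ w, HasDerivAt A (1 * exp w + (a - 1)) w := hasDerivAt_mul_exp_add 1 (a - 1)
  have hAd : Differentiable ℂ (fun w => -Gamma a * exp (-A w)) := fun w =>
    ((hA w).neg.cexp.const_mul _).differentiableAt
  obtain ⟨P, hP0, hP⟩ := hAd.isExactOn_univ.with_val_at 0
    (exp (-A 0) * stieltjes (gammaKernel 1 a) 0)
  have hg : ∀ w, HasDerivAt (fun w => exp (A w) * P w)
      ((1 * exp w + (a - 1)) * (exp (A w) * P w) + -Gamma a) w := fun w => by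
    refine ((hA w).cexp.mul (hP w (mem_univ w))).congr_deriv ?_
    have : exp (A w) * exp (-A w) = 1 := by rw [← exp_add, add_neg_cancel, exp_zero]
    linear_combination -Gamma a * this
  have hs : {w : ℂ | |w.im| < Real.pi} = {w : ℂ | |w.im - 0| < Real.pi} := by simp
  refine ⟨fun w => exp (A w) * P w, fun w => (hg w).congr_deriv (by ring), ?_⟩
  rw [hs]
  refine eqOn_of_linear_ode (isOpen_strip 0 _) (convex_strip 0 _).isPreconnected
    (fun w _ => hA w) (fun w _ => hg w) (r := fun _ => -Gamma a) (fun w hw => ?_) (w₀ := 0)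
    (by simpa using Real.pi_pos) ?_
  · refine (hasDerivAt_stieltjes_gammaKernel ha (b := 1) (by simp) (by simpa using hw)).congr_deriv ?_
    rw [integral_gammaKernel_one ha]; ring
  · rw [hP0, ← mul_assoc, ← exp_add, add_neg_cancel, exp_zero, one_mul]

/-- The entire continuation of the Stieltjes transform of `e^{-u} u^{a-1}`, as a function of the
logarithm. -/
noncomputable def entireStieltjes (a : ℂ) : ℂ → ℂ :=
  Classical.epsilon fun g : ℂ → ℂ =>
    (∀ w, HasDerivAt g ((exp w + (a - 1)) * g w - Gamma a) w) ∧
      EqOn g (stieltjes (gammaKernel 1 a)) {w | |w.im| < Real.pi}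

section entireStieltjes

variable {a : ℂ}

theorem hasDerivAt_entireStieltjes (ha : 0 < a.re) (w : ℂ) :
    HasDerivAt (entireStieltjes a) ((exp w + (a - 1)) * entireStieltjes a w - Gamma a) w :=
  (Classical.epsilon_spec (exists_entire_stieltjes_gammaKernel ha)).1 w

theorem differentiable_entireStieltjes (ha : 0 < a.re) : Differentiable ℂ (entireStieltjes a) :=
  fun w => (hasDerivAt_entireStieltjes ha w).differentiableAt

theorem entireStieltjes_eq (ha : 0 < a.re) {w : ℂ} (hw : |w.im| < Real.pi) :
    entireStieltjes a w = stieltjes (gammaKernel 1 a) w :=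
  (Classical.epsilon_spec (exists_entire_stieltjes_gammaKernel ha)).2 hw

end entireStieltjes

/-! ### Rotation of the ray and decay beyond the principal strip -/

theorem re_mul_exp_ray (y : ℂ) (x ω : ℝ) :
    (y * exp (x + ω * I)).re = (y * exp (ω * I)).re * Real.exp x := by
  rw [exp_add, ← ofReal_exp, show y * ((Real.exp x : ℂ) * exp (ω * I)) =
    y * exp (ω * I) * (Real.exp x : ℂ) by ring, re_mul_ofReal]

/-- The doubly exponential factor beats the exponential `n * (x + ω * I)`. This limit is what forces
constants of integration to vanish. -/
theorem tendsto_exp_neg_ray {y : ℂ} (n : ℂ) {ω : ℝ} (hy : 0 < (y * exp (ω * I)).re) :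
    Tendsto (fun x : ℝ => exp (-(y * exp (x + ω * I) + n * (x + ω * I)))) atTop (𝓝 0) := by
  have h1 := ((tendsto_rpow_mul_exp_neg_mul_atTop_nhds_zero (-n.re) _ hy).comp
    Real.tendsto_exp_atTop).mul_const (Real.exp (n.im * ω))
  rw [zero_mul] at h1
  refine squeeze_zero_norm (fun x => le_of_eq ?_) h1
  rw [norm_exp]
  simp only [Function.comp, ← Real.exp_mul, ← Real.exp_add, neg_re, add_re, re_mul_exp_ray]
  congr 1
  simp
  ring

/-- The rotated integral representation. -/
theorem entireStieltjes_eq_rotated {a w : ℂ} (ha : 0 < a.re) {β : ℝ} (hβ : |β| < Real.pi / 2)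
    (hw : |w.im - β| < Real.pi) :
    entireStieltjes a w =
      exp (β * I * (a - 1)) * stieltjes (gammaKernel (exp (β * I)) a) (w - β * I) := by
  have hb : 0 < (exp (β * I)).re := re_exp_pos (by simpa using hβ)
  have hpi := Real.pi_pos
  have him : ∀ w : ℂ, (w - β * I).im = w.im - β := fun w => by simp
  obtain ⟨κ, hκ⟩ := exists_sub_eq_mul_exp (isOpen_strip β Real.pi)
    (convex_strip β _).isPreconnected (g₁ := entireStieltjes a)
    (g₂ := fun w => exp (β * I * (a - 1)) * stieltjes (gammaKernel (exp (β * I)) a) (w - β * I))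
    (r := fun _ => -Gamma a) (fun w _ => hasDerivAt_mul_exp_add 1 (a - 1) w)
    (fun w _ => (hasDerivAt_entireStieltjes ha w).congr_deriv (by ring)) (fun w hw => by
      have h1 := hasDerivAt_stieltjes_gammaKernel ha hb (w := w - β * I) (by rw [him]; exact hw)
      refine ((h1.comp_sub_const w _).const_mul _).congr_deriv ?_
      rw [integral_gammaKernel_exp ha (by simpa using hβ), exp_sub]
      have e1 : exp (β * I) * exp (β * I * (a - 1)) * exp (-a * (β * I)) = 1 := by
        rw [← exp_add, ← exp_add,
          show β * I + β * I * (a - 1) + -a * (β * I) = 0 by ring, exp_zero]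
      have e2 : exp (β * I) * (exp w / exp (β * I)) = exp w := mul_div_cancel₀ _ (exp_ne_zero _)
      rw [e2]
      linear_combination (-Gamma a) * e1)
  have hk : κ = 0 := by
    -- The ray Im w = β/2 lies in both strips and its direction has positive cosine, so both
    -- transforms decay there while the homogeneous solution blows up.
    have hβ2 : |β / 2| < Real.pi / 2 := by rw [abs_div, abs_two]; linarith [abs_nonneg β]
    have h0 := tendsto_exp_neg_ray (y := 1) (a - 1) (ω := β / 2) (by
      rw [one_mul]; exact re_exp_pos (by simpa using hβ2))
    have hex : Tendsto (fun x : ℝ => Real.exp (-x)) atTop (𝓝 0) :=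
      Real.tendsto_exp_neg_atTop_nhds_zero
    have hin : ∀ x : ℝ, (x + ((β / 2 : ℝ) : ℂ) * I).im = β / 2 := fun x => by simp
    have hre : ∀ x : ℝ, (x + ((β / 2 : ℝ) : ℂ) * I).re = x := fun x => by simp
    have hβ3 : |β / 2 - β| < Real.pi / 2 := by
      rw [show β / 2 - β = -(β / 2) by ring, abs_neg]; exact hβ2
    have h1 : Tendsto (fun x : ℝ => entireStieltjes a (x + ((β / 2 : ℝ) : ℂ) * I)) atTop (𝓝 0) := by
      have := hex.const_mul ((∫ u in Ioi (0 : ℝ), ‖gammaKernel 1 a u‖) *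
        (Real.cos (|β / 2| / 2))⁻¹)
      rw [mul_zero] at this
      refine squeeze_zero_norm (fun x => ?_) this
      rw [entireStieltjes_eq ha (by rw [hin]; linarith)]
      have h := norm_stieltjes_le (integrableOn_gammaKernel (b := 1) (by simp) ha)
        (w := x + ((β / 2 : ℝ) : ℂ) * I) (δ := |β / 2|) (by rw [hin]) (by linarith)
      rwa [hre] at h
    have h2 : Tendsto (fun x : ℝ => stieltjes (gammaKernel (exp (β * I)) a)
        (x + ((β / 2 : ℝ) : ℂ) * I - β * I)) atTop (𝓝 0) := by
      have := hex.const_mul ((∫ u in Ioi (0 : ℝ), ‖gammaKernel (exp (β * I)) a u‖) *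
        (Real.cos (|β / 2 - β| / 2))⁻¹)
      rw [mul_zero] at this
      refine squeeze_zero_norm (fun x => ?_) this
      have h := norm_stieltjes_le (integrableOn_gammaKernel hb ha)
        (w := x + ((β / 2 : ℝ) : ℂ) * I - β * I) (δ := |β / 2 - β|) (by rw [him, hin])
        (by linarith)
      rw [sub_re, hre] at h
      simpa using h
    have h3 := h0.mul (h1.sub (h2.const_mul (exp (β * I * (a - 1)))))
    simp only [mul_zero, sub_zero] at h3
    refine tendsto_nhds_unique (tendsto_const_nhds.congr fun x => ?_) h3
    have h4 := hκ (x + ((β / 2 : ℝ) : ℂ) * I) (by simp only [mem_ofPred_eq, hin]; linarith)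
    simp only [ofReal_div, ofReal_ofNat] at h4 ⊢
    rw [h4, mul_left_comm, ← exp_add, neg_add_cancel, exp_zero, mul_one]
  have := hκ w hw
  rwa [hk, zero_mul, sub_eq_zero] at this

/-- The rotated representation bounds the continuation on strips of half-width below π about any |β|
< π/2, so the decay e^{-Re w} is available for all |Im w| < 3π/2. -/
theorem exists_norm_entireStieltjes_le {a : ℂ} (ha : 0 < a.re) {β δ : ℝ} (hβ : |β| < Real.pi / 2)
    (hδ : δ < Real.pi) :
    ∃ C, 0 ≤ C ∧ ∀ w : ℂ, |w.im - β| ≤ δ → ‖entireStieltjes a w‖ ≤ C * Real.exp (-w.re) := by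
  rcases lt_or_ge δ 0 with h0 | h0
  · exact ⟨0, le_rfl, fun w hw => absurd (hw.trans_lt h0) (not_lt.2 (abs_nonneg _))⟩
  have hb : 0 < (exp (β * I)).re := re_exp_pos (by simpa using hβ)
  have hc := cos_half_pos h0 hδ
  have hI : 0 ≤ ∫ u in Ioi (0 : ℝ), ‖gammaKernel (exp (β * I)) a u‖ :=
    integral_nonneg fun _ => norm_nonneg _
  refine ⟨‖exp (β * I * (a - 1))‖ * ((∫ u in Ioi (0 : ℝ), ‖gammaKernel (exp (β * I)) a u‖) *
    (Real.cos (δ / 2))⁻¹), by positivity, fun w hw => ?_⟩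
  rw [entireStieltjes_eq_rotated ha hβ (hw.trans_lt hδ), norm_mul,
    mul_assoc ‖exp (β * I * (a - 1))‖]
  refine mul_le_mul_of_nonneg_left ?_ (norm_nonneg _)
  have h := norm_stieltjes_le (integrableOn_gammaKernel hb ha)
    (w := w - β * I) (δ := δ) (by simpa using hw) hδ
  simpa using h

/-! ### The inner kernel, its Stieltjes transform and its moment -/

theorem exp_ofReal_log_add {u : ℝ} (hu : 0 < u) (m : ℂ) :
    exp ((Real.log u : ℂ) + m) = u * exp m := by
  rw [exp_add, ← ofReal_exp, Real.exp_log hu]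

theorem rpow_mul_rpow_one_sub_le_add {u v θ : ℝ} (hu : 0 ≤ u) (hv : 0 ≤ v) (h0 : 0 ≤ θ)
    (h1 : θ ≤ 1) : u ^ θ * v ^ (1 - θ) ≤ u + v := by
  have := Real.geom_mean_le_arith_mean2_weighted h0 (sub_nonneg.2 h1) hu hv (by ring)
  nlinarith

/-- The denominator satisfies |u e^m + v| ≥ κ u^θ v^{1-θ} by the weighted mean inequality. This
trades a singularity u^{-θ} at 0 for v-integrability, which needs θ > 1 - Re a. -/
theorem exists_norm_stieltjes_log_add_le {a : ℂ} {θ δ r : ℝ} (h0 : 0 ≤ θ) (h1 : θ ≤ 1)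
    (ha : 1 - a.re < θ) (hδ0 : 0 ≤ δ) (hδ : δ < Real.pi) :
    ∃ C, 0 ≤ C ∧ ∀ m : ℂ, |m.im| ≤ δ → r ≤ m.re → ∀ u : ℝ, 0 < u →
      ‖stieltjes (gammaKernel 1 a) (Real.log u + m)‖ ≤ C * u ^ (-θ) := by
  have hc := cos_half_pos hδ0 hδ
  -- The minimum bounds both coefficients of u e^{Re m} + v from below, uniformly in `m`.
  set κ := Real.cos (δ / 2) * min (Real.exp r) 1 with hκ
  have hκ0 : 0 < κ := mul_pos hc (lt_min (Real.exp_pos _) one_pos)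
  have hint := integrableOn_rpow_mul_exp_neg (p := a.re - 1 + θ) (q := 1) (by linarith) one_pos
  refine ⟨κ⁻¹ * ∫ v in Ioi (0 : ℝ), v ^ (a.re - 1 + θ - 1) * Real.exp (-1 * v), ?_,
    fun m hm hmr u hu => ?_⟩
  · exact mul_nonneg (by positivity) (setIntegral_nonneg measurableSet_Ioi fun v hv => by
      have : (0 : ℝ) < v := hv
      positivity)
  rw [mul_right_comm, ← integral_const_mul]
  refine norm_integral_le_of_norm_le (hint.const_mul _)
    ((ae_restrict_iff' measurableSet_Ioi).2 (Eventually.of_forall fun v hv => ?_))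
  have hv : (0 : ℝ) < v := hv
  have hlow : κ * (u ^ θ * v ^ (1 - θ)) ≤ ‖exp ((Real.log u : ℂ) + m) + v‖ := by
    have h2 := cos_half_mul_le_norm_exp_add (w := (Real.log u : ℂ) + m) (u := v) (δ := δ)
      (by simpa using hm) hδ
    refine le_trans ?_ h2
    rw [hκ, mul_assoc]
    refine mul_le_mul_of_nonneg_left ?_ hc.le
    have h3 : Real.exp ((Real.log u : ℂ) + m).re = u * Real.exp m.re := by
      rw [add_re, ofReal_re, Real.exp_add, Real.exp_log hu]
    rw [h3]
    calc min (Real.exp r) 1 * (u ^ θ * v ^ (1 - θ)) ≤ min (Real.exp r) 1 * (u + v) := by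
          gcongr
          exact rpow_mul_rpow_one_sub_le_add hu.le hv.le h0 h1
      _ = u * min (Real.exp r) 1 + min (Real.exp r) 1 * v := by ring
      _ ≤ u * Real.exp m.re + 1 * v := by
          gcongr
          · exact (min_le_left _ _).trans (Real.exp_le_exp.2 hmr)
          · exact min_le_right _ _
      _ = _ := by ring
  rw [norm_div, norm_gammaKernel _ _ hv, one_re]
  have hpos : 0 < κ * (u ^ θ * v ^ (1 - θ)) := by positivity
  refine (div_le_div_of_nonneg_left (by positivity) hpos hlow).trans (le_of_eq ?_)
  have e1 : v ^ (a.re - 1) = v ^ (a.re - 1 + θ - 1) * v ^ (1 - θ) := by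
    rw [← Real.rpow_add hv]; congr 1; ring
  have hvp : v ^ (1 - θ) ≠ 0 := by positivity
  rw [e1, Real.rpow_neg hu.le]
  field_simp

/-- The integrand of the outer integral of the second hyperterminant, normalized. -/
noncomputable def innerKernel (N₀ N₁ m : ℂ) (u : ℝ) : ℂ :=
  gammaKernel 1 (N₀ + 1) u * stieltjes (gammaKernel 1 (N₁ + 1)) (Real.log u + m)

section innerKernel

variable {N₀ N₁ : ℂ}

theorem hasDerivAt_stieltjes_gammaKernel_one {a w : ℂ} (ha : 0 < a.re) (hw : |w.im| < Real.pi) :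
    HasDerivAt (stieltjes (gammaKernel 1 a)) ((exp w + (a - 1)) * stieltjes (gammaKernel 1 a) w -
      Gamma a) w := by
  simpa [integral_gammaKernel_one ha] using
    hasDerivAt_stieltjes_gammaKernel ha (b := 1) (by simp) hw

/-- Product rule with the equations of the Gamma kernel and of S_{N₁+1}: the exponential rates
combine to 1 - e^m, the powers to N₀ + N₁, and Γ(N₁+1) becomes the forcing term. -/
theorem hasDerivAt_innerKernel (hN₁ : -1 < N₁.re) {m : ℂ} (hm : |m.im| < Real.pi) (u : ℝ)
    (hu : u > 0) : HasDerivAt (innerKernel N₀ N₁ m)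
      (((-(1 - exp m) * u + (N₀ + N₁)) * innerKernel N₀ N₁ m u +
        -Gamma (N₁ + 1) * gammaKernel 1 (N₀ + 1) u) / u) u := by
  have h0 : (u : ℂ) ≠ 0 := by exact_mod_cast hu.ne'
  have h1 := hasDerivAt_stieltjes_gammaKernel_one (a := N₁ + 1) (w := (Real.log u : ℂ) + m)
    (by simpa using by linarith) (by simpa using hm)
  have h2 := (Real.hasDerivAt_log hu.ne').ofReal_comp.add_const m
  refine ((hasDerivAt_gammaKernel 1 (N₀ + 1) hu).mul (h1.comp u h2)).congr_deriv ?_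
  simp only [innerKernel, Function.comp, exp_ofReal_log_add hu]
  push_cast
  field_simp
  ring

theorem exists_norm_innerKernel_le (hN₀ : -1 < N₀.re) (hN₁ : -1 < N₁.re)
    (hN : -1 < (N₀ + N₁).re) {δ : ℝ} (r : ℝ) (hδ0 : 0 ≤ δ) (hδ : δ < Real.pi) :
    ∃ C p : ℝ, 0 < p ∧ ∀ m : ℂ, |m.im| ≤ δ → r ≤ m.re → ∀ u > 0,
      ‖innerKernel N₀ N₁ m u‖ ≤ C * (u ^ (p - 1) * Real.exp (-1 * u)) := by
  -- The three conditions on Re N₀, Re N₁ and Re(N₀ + N₁) are what makes this interval for θ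
  -- non-empty.
  obtain ⟨θ, hθ1, hθ2⟩ : ∃ θ, max 0 (-N₁.re) < θ ∧ θ < min 1 (1 + N₀.re) := by
    refine exists_between (max_lt ?_ ?_) <;> refine lt_min ?_ ?_ <;>
      simp only [add_re] at hN <;> linarith
  obtain ⟨h1, h2⟩ := max_lt_iff.1 hθ1
  obtain ⟨h3, h4⟩ := lt_min_iff.1 hθ2
  obtain ⟨C, hC0, hC⟩ := exists_norm_stieltjes_log_add_le (a := N₁ + 1) (r := r) h1.le h3.le
    (by simp only [add_re, one_re]; linarith) hδ0 hδ
  refine ⟨C, N₀.re + 1 - θ, by linarith, fun m hm hmr u hu => ?_⟩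
  rw [innerKernel, norm_mul, norm_gammaKernel _ _ hu]
  refine (mul_le_mul_of_nonneg_left (hC m hm hmr u hu) (by positivity)).trans (le_of_eq ?_)
  rw [show N₀.re + 1 - θ - 1 = (N₀ + 1).re - 1 + -θ by simp only [add_re, one_re]; ring,
    Real.rpow_add hu, one_re]
  ring

theorem continuousOn_innerKernel (hN₁ : -1 < N₁.re) {m : ℂ} (hm : |m.im| < Real.pi) :
    ContinuousOn (innerKernel N₀ N₁ m) (Ioi 0) :=
  fun u hu => (hasDerivAt_innerKernel hN₁ hm u hu).continuousAt.continuousWithinAt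

theorem integrableOn_innerKernel (hN₀ : -1 < N₀.re) (hN₁ : -1 < N₁.re)
    (hN : -1 < (N₀ + N₁).re) {m : ℂ} (hm : |m.im| < Real.pi) :
    IntegrableOn (innerKernel N₀ N₁ m) (Ioi 0) := by
  obtain ⟨C, p, hp, hC⟩ := exists_norm_innerKernel_le hN₀ hN₁ hN m.re (abs_nonneg m.im) hm
  exact integrableOn_of_norm_le_rpow_mul_exp hp one_pos (continuousOn_innerKernel hN₁ hm)
    (hC m le_rfl le_rfl)

theorem integrableOn_gammaKernel_add_one (hN₀ : -1 < N₀.re) :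
    IntegrableOn (gammaKernel 1 (N₀ + 1)) (Ioi 0) :=
  integrableOn_gammaKernel (by simp) (by simpa using by linarith)

/-- The integral of `innerKernel`, which does not depend on the point `z`. -/
noncomputable def innerMoment (N₀ N₁ m : ℂ) : ℂ := ∫ u in Ioi (0 : ℝ), innerKernel N₀ N₁ m u

theorem hasDerivAt_stieltjes_innerKernel (hN₀ : -1 < N₀.re) (hN₁ : -1 < N₁.re)
    (hN : -1 < (N₀ + N₁).re) {m w : ℂ} (hm : |m.im| < Real.pi) (hw : |w.im| < Real.pi) :
    HasDerivAt (stieltjes (innerKernel N₀ N₁ m))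
      (((1 - exp m) * exp w + (N₀ + N₁)) * stieltjes (innerKernel N₀ N₁ m) w -
        ((1 - exp m) * innerMoment N₀ N₁ m +
          Gamma (N₁ + 1) * stieltjes (gammaKernel 1 (N₀ + 1)) w)) w := by
  obtain ⟨C, p, hp, hC⟩ := exists_norm_innerKernel_le hN₀ hN₁ hN m.re (abs_nonneg m.im) hm
  refine (hasDerivAt_stieltjes_of_hasDerivAt hp one_pos (hC m le_rfl le_rfl)
    (hasDerivAt_innerKernel hN₁ hm) ((integrableOn_gammaKernel_add_one hN₀).const_mul _)
    hw).congr_deriv ?_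
  have : stieltjes (fun u => -Gamma (N₁ + 1) * gammaKernel 1 (N₀ + 1) u) w =
      -Gamma (N₁ + 1) * stieltjes (gammaKernel 1 (N₀ + 1)) w := by
    simp only [stieltjes, mul_div_assoc, integral_const_mul]
  rw [this, innerMoment]
  ring

/-- Differentiating in m brings in ∫ u φ, which the vanishing of ∫ (uφ)' eliminates. The factor 1 -
e^m stays on the left because it vanishes at m = 0. -/
theorem hasDerivAt_innerMoment (hN₀ : -1 < N₀.re) (hN₁ : -1 < N₁.re)
    (hN : -1 < (N₀ + N₁).re) {m : ℂ} (hm : |m.im| < Real.pi) :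
    ∃ D, HasDerivAt (innerMoment N₀ N₁) D m ∧
      (1 - exp m) * D = (exp m * (N₀ + 1) + N₁) * innerMoment N₀ N₁ m -
        Gamma (N₀ + 1) * Gamma (N₁ + 1) := by
  obtain ⟨δ, hδ1, hδ⟩ := exists_between hm
  have hd0 : 0 ≤ δ := (abs_nonneg _).trans hδ1.le
  obtain ⟨C, p, hp, hC⟩ := exists_norm_innerKernel_le hN₀ hN₁ hN (m.re - 1) hd0 hδ
  have hCm := hC m hδ1.le (by linarith)
  have hU : {z : ℂ | |z.im| < δ ∧ m.re - 1 < z.re} ∈ 𝓝 m :=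
    ((isOpen_lt (f := fun z : ℂ => |z.im|) (by fun_prop) continuous_const).inter
      (isOpen_lt (f := fun _ : ℂ => m.re - 1) continuous_const continuous_re)).mem_nhds
      ⟨hδ1, by simp⟩
  have hder : ∀ u ∈ Ioi (0 : ℝ), ∀ z : ℂ, |z.im| < Real.pi →
      HasDerivAt (fun z => innerKernel N₀ N₁ z u)
        (exp z * (u * innerKernel N₀ N₁ z u) + N₁ * innerKernel N₀ N₁ z u +
          -Gamma (N₁ + 1) * gammaKernel 1 (N₀ + 1) u) z := fun u hu z hz => by
    have h1 := hasDerivAt_stieltjes_gammaKernel_one (a := N₁ + 1) (w := (Real.log u : ℂ) + z)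
      (by simpa using by linarith) (by simpa using hz)
    refine ((h1.comp_const_add (Real.log u : ℂ) z).const_mul
      (gammaKernel 1 (N₀ + 1) u)).congr_deriv ?_
    rw [exp_ofReal_log_add hu, innerKernel]
    ring
  have key := hasDerivAt_integral_of_differentiableOn_of_norm_le
    (μ := volume.restrict (Ioi 0)) (f := fun z (u : ℝ) => innerKernel N₀ N₁ z u) hU
    (fun z hz => (continuousOn_innerKernel hN₁ (hz.1.trans hδ)).aestronglyMeasurable
      measurableSet_Ioi)
    ((ae_restrict_iff' measurableSet_Ioi).2 (Eventually.of_forall fun u hu z hz =>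
      (hder u hu z (hz.1.trans hδ)).differentiableAt.differentiableWithinAt))
    ((ae_restrict_iff' measurableSet_Ioi).2 (Eventually.of_forall fun u hu z hz =>
      hC z hz.1.le hz.2.le u hu))
    ((integrableOn_rpow_mul_exp_neg hp one_pos).const_mul C)
  refine ⟨_, key.2, ?_⟩
  have hi := integrableOn_innerKernel hN₀ hN₁ hN hm
  have hi1 : IntegrableOn (fun u : ℝ => (u : ℂ) * innerKernel N₀ N₁ m u) (Ioi 0) :=
    integrableOn_of_norm_le_rpow_mul_exp (p := p + 1) (by linarith) one_pos
      (ContinuousOn.mul (by fun_prop) (continuousOn_innerKernel hN₁ hm))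
      (norm_ofReal_mul_le_rpow_mul_exp hCm)
  have hψ := (integrableOn_gammaKernel_add_one hN₀).const_mul (-Gamma (N₁ + 1))
  have hI := integral_eq_of_hasDerivAt hp one_pos hCm (hasDerivAt_innerKernel hN₁ hm) hψ
  rw [setIntegral_congr_fun measurableSet_Ioi (fun u hu => (hder u hu m hm).deriv),
    integral_add (f := fun u : ℝ => exp m * (u * innerKernel N₀ N₁ m u) +
      N₁ * innerKernel N₀ N₁ m u) ((hi1.const_mul _).add (hi.const_mul _)) hψ,
    integral_add (hi1.const_mul _) (hi.const_mul _), integral_const_mul, integral_const_mul]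
  rw [integral_const_mul, integral_gammaKernel_one (by simpa using by linarith),
    ← innerMoment] at hI ⊢
  linear_combination (-exp m) * hI

end innerKernel

/-! ### The first-order equation of ₂F₁(1, b; c; y) -/

/-- One differentiation of the first-order equation gives Gauss's equation with a = 1, and further
ones give its derivatives. At y = 0 they become the recursion for the Taylor coefficients. -/
theorem iterate_deriv_of_hypergeometric_ode {f : ℂ → ℂ} {b c : ℂ}
    (hf : DifferentiableOn ℂ f (Metric.ball 0 1))
    (h : ∀ y ∈ Metric.ball (0 : ℂ) 1, y * (1 - y) * deriv f y + (c - 1 - b * y) * f y = c - 1)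
    (k : ℕ) : ∀ y ∈ Metric.ball (0 : ℂ) 1, y * (1 - y) * deriv^[k + 2] f y +
      (c + k - (b + 2 * k + 2) * y) * deriv^[k + 1] f y - (k + 1) * (k + b) * deriv^[k] f y = 0 := by
  have han : ∀ k, ∀ y ∈ Metric.ball (0 : ℂ) 1,
      HasDerivAt (deriv^[k] f) (deriv^[k + 1] f y) y := fun k y hy => by
    have := (((hf.analyticOnNhd Metric.isOpen_ball).iterated_deriv k) y hy).differentiableAt.hasDerivAt
    rwa [← Function.iterate_succ_apply' deriv] at this
  have hpoly : ∀ y : ℂ, HasDerivAt (fun y : ℂ => y * (1 - y)) (1 - 2 * y) y := fun y => by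
    refine ((hasDerivAt_id y).mul ((hasDerivAt_id y).const_sub 1)).congr_deriv ?_
    simp only [id]; ring
  have hlin : ∀ (p q y : ℂ), HasDerivAt (fun y : ℂ => p - q * y) (-q) y := fun p q y => by
    simpa using ((hasDerivAt_id y).const_mul q).const_sub p
  have zero : ∀ (E : ℂ → ℂ) (E' κ : ℂ) (y : ℂ), y ∈ Metric.ball (0 : ℂ) 1 →
      (∀ x ∈ Metric.ball (0 : ℂ) 1, E x = κ) → HasDerivAt E E' y → E' = 0 :=
    fun E E' κ y hy hE hd => by
      have h0 : HasDerivAt E 0 y := (hasDerivAt_const y κ).congr_of_eventuallyEq (by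
        filter_upwards [Metric.isOpen_ball.mem_nhds hy] with x hx using hE x hx)
      exact hd.unique h0
  induction k with
  | zero =>
    intro y hy
    have := zero _ _ _ y hy h (((hpoly y).mul (han 1 y hy)).add
      ((hlin (c - 1) b y).mul (han 0 y hy)))
    simp only [Function.iterate_succ, Function.iterate_zero, Function.comp, id] at this ⊢
    push_cast
    linear_combination this
  | succ k ih =>
    intro y hy
    have := zero _ _ _ y hy ih ((((hpoly y).mul (han (k + 2) y hy)).add
      ((hlin (c + k) (b + 2 * k + 2) y).mul (han (k + 1) y hy))).sub
      ((han k y hy).const_mul ((k + 1) * (k + b))))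
    push_cast
    linear_combination this

/-- The hypergeometric function `₂F₁(1, b; c; y)` is the solution of its first-order differential
equation that is holomorphic in the unit disc. -/
theorem eq_ordinaryHypergeometric_of_ode {f : ℂ → ℂ} {b c : ℂ} (hc : 1 < c.re)
    (hf : DifferentiableOn ℂ f (Metric.ball 0 1))
    (h : ∀ y ∈ Metric.ball (0 : ℂ) 1, y * (1 - y) * deriv f y + (c - 1 - b * y) * f y = c - 1)
    {y : ℂ} (hy : ‖y‖ < 1) : f y = ordinaryHypergeometric 1 b c y := by
  have h0 : (0 : ℂ) ∈ Metric.ball (0 : ℂ) 1 := Metric.mem_ball_self one_pos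
  have hck : ∀ k : ℕ, c + k ≠ 0 := fun k hk => by
    have := congrArg re hk
    simp only [add_re, natCast_re, zero_re] at this
    linarith [(Nat.cast_nonneg k : (0 : ℝ) ≤ k)]
  have hcoef : ∀ k : ℕ, deriv^[k] f 0 * (ascPochhammer ℂ k).eval c =
      k.factorial * (ascPochhammer ℂ k).eval b := fun k => by
    induction k with
    | zero =>
      -- At y = 0 the first-order equation reads (c - 1) f(0) = c - 1, which fixes f(0) = 1.
      have hc1 : c - 1 ≠ 0 := fun hk => by
        have := congrArg re hk
        simp only [sub_re, one_re, zero_re] at this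
        linarith
      have := h 0 h0
      simp only [zero_mul, mul_zero, sub_zero, zero_add] at this
      simpa using mul_left_cancel₀ hc1 (this.trans (mul_one _).symm)
    | succ k ih =>
      have := iterate_deriv_of_hypergeometric_ode hf h k 0 h0
      simp only [zero_mul, mul_zero, sub_zero, zero_add] at this
      rw [ascPochhammer_succ_eval, ascPochhammer_succ_eval, Nat.factorial_succ]
      push_cast
      linear_combination (ascPochhammer ℂ k).eval c * this + (k + 1) * (k + b) * ih
  have hpc : ∀ k : ℕ, (ascPochhammer ℂ k).eval c ≠ 0 := fun k hk => by
    rw [ascPochhammer_eval_eq_zero_iff] at hk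
    obtain ⟨j, -, hj⟩ := hk
    exact hck j (by rw [hj]; ring)
  have hs := hasSum_taylorSeries_on_ball (r := 1) (c := 0) (f := f)
    (by simpa using hf) (z := y) (by simpa using hy)
  rw [ordinaryHypergeometric_eq_tsum, ← hs.tsum_eq]
  refine tsum_congr fun k => ?_
  have hk := hcoef k
  have hfac : (k.factorial : ℂ) ≠ 0 := by exact_mod_cast k.factorial_ne_zero
  rw [ascPochhammer_eval_one, iteratedDeriv_eq_iterate, inv_mul_cancel₀ hfac, one_mul, sub_zero,
    eq_div_of_mul_eq (hpc k) hk]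
  simp only [smul_eq_mul]
  field_simp

/-! ### Geometry of the domain of log(σ₁/σ₀) -/

theorem isOpen_ratioDomain : IsOpen ratioDomain :=
  isOpen_slitPlane.preimage (by fun_prop)

theorem one_add_exp_ne_zero {l : ℂ} (hl : l ∈ ratioDomain) : 1 + exp l ≠ 0 :=
  slitPlane_ne_zero hl

theorem re_neg_subset_ratioDomain : {l : ℂ | l.re < 0} ⊆ ratioDomain := fun l hl => by
  refine mem_slitPlane_iff.2 (Or.inl ?_)
  have h1 : ‖exp l‖ < 1 := by rw [norm_exp]; simpa using hl
  have h2 := neg_le_of_abs_le (abs_re_le_norm (exp l))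
  simp only [add_re, one_re]
  linarith

/-- The excluded values of e^l form (-∞, -1], and shrinking e^l towards 0 never enters this
half-line. Connectedness and primitives thus reduce to the left half-plane. -/
theorem sub_mem_ratioDomain : ∀ l ∈ ratioDomain, ∀ t : ℝ, 0 ≤ t → l - t ∈ ratioDomain := by
  intro l hl t ht
  have hl : 1 + exp l ∈ slitPlane := hl
  have h1 : exp l = Real.exp t * exp (l - t) := by
    rw [ofReal_exp, ← exp_add]; congr 1; ring
  have h2 : 1 ≤ Real.exp t := Real.one_le_exp ht
  change 1 + exp (l - t) ∈ slitPlane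
  rw [mem_slitPlane_iff] at hl ⊢
  rw [h1] at hl
  simp only [add_re, one_re, add_im, one_im, zero_add, re_ofReal_mul, im_ofReal_mul] at hl ⊢
  by_contra! hcon
  rw [hcon.2, mul_zero] at hl
  rcases hl with hl | hl
  · nlinarith [hcon.1]
  · exact hl rfl

theorem isPreconnected_ratioDomain : IsPreconnected ratioDomain := by
  refine isPreconnected_of_sub_mem sub_mem_ratioDomain ?_
  rw [inter_eq_self_of_subset_right re_neg_subset_ratioDomain]
  exact (convex_halfSpace_re_lt 0).isPreconnected

theorem isPreconnected_ratioDomain_inter_strip (β r : ℝ) :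
    IsPreconnected (ratioDomain ∩ {l | |l.im - β| < r}) := by
  refine isPreconnected_of_sub_mem (fun l hl t ht => ⟨sub_mem_ratioDomain l hl.1 t ht, ?_⟩) ?_
  · simpa using hl.2
  · rw [inter_right_comm, inter_eq_self_of_subset_right re_neg_subset_ratioDomain]
    exact ((convex_halfSpace_re_lt 0).inter (convex_strip β r)).isPreconnected

/-! ### The moment as a hypergeometric function and its continuation -/

section hypergeometric

variable {N₀ N₁ : ℂ}

theorem add_one_ne_zero_of_re {N : ℂ} (hN : -1 < N.re) : N + 1 ≠ 0 := fun h => by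
  have := congrArg re h
  simp only [add_re, one_re, zero_re] at this
  linarith

theorem Gamma_add_one_ne_zero {N : ℂ} (hN : -1 < N.re) : Gamma (N + 1) ≠ 0 :=
  Gamma_ne_zero_of_re_pos (by simpa using by linarith)

/-- The moment `innerMoment`, normalized to be `1` at `m = 0`. -/
noncomputable def normalizedMoment (N₀ N₁ m : ℂ) : ℂ :=
  (N₀ + N₁ + 1) / (Gamma (N₀ + 1) * Gamma (N₁ + 1)) * innerMoment N₀ N₁ m

theorem hasDerivAt_normalizedMoment (hN₀ : -1 < N₀.re) (hN₁ : -1 < N₁.re)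
    (hN : -1 < (N₀ + N₁).re) {m : ℂ} (hm : |m.im| < Real.pi) :
    ∃ D, HasDerivAt (normalizedMoment N₀ N₁) D m ∧
      (1 - exp m) * D = (exp m * (N₀ + 1) + N₁) * normalizedMoment N₀ N₁ m - (N₀ + N₁ + 1) := by
  obtain ⟨D, hD, h⟩ := hasDerivAt_innerMoment hN₀ hN₁ hN hm
  refine ⟨_, hD.const_mul _, ?_⟩
  have h0 := Gamma_add_one_ne_zero hN₀
  have h1 := Gamma_add_one_ne_zero hN₁
  rw [normalizedMoment, mul_left_comm, h]
  field_simp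

/-- Under y = 1 - e^m the equation of the moment becomes that of ₂F₁. The moment is holomorphic near
m = 0, hence in the whole disc |y| < 1. -/
theorem normalizedMoment_eq_ordinaryHypergeometric (hN₀ : -1 < N₀.re) (hN₁ : -1 < N₁.re)
    (hN : -1 < (N₀ + N₁).re) {m : ℂ} (hm : |m.im| < Real.pi) (h1 : ‖1 - exp m‖ < 1) :
    normalizedMoment N₀ N₁ m =
      ordinaryHypergeometric 1 (N₀ + 1) (N₀ + N₁ + 2) (1 - exp m) := by
  have hder : ∀ y ∈ Metric.ball (0 : ℂ) 1, ∃ D,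
      HasDerivAt (fun y => normalizedMoment N₀ N₁ (log (1 - y))) D y ∧
      y * (1 - y) * D + (N₀ + N₁ + 2 - 1 - (N₀ + 1) * y) * normalizedMoment N₀ N₁ (log (1 - y)) =
        N₀ + N₁ + 2 - 1 := by
    intro y hy
    rw [mem_ball_zero_iff] at hy
    have hre : 0 < (1 - y).re := by
      have := (abs_le.1 (abs_re_le_norm y)).2
      simp only [sub_re, one_re]; linarith
    have hne : 1 - y ≠ 0 := fun h => by rw [h] at hre; simp at hre
    have him : |(log (1 - y)).im| < Real.pi := by
      rw [log_im]
      exact (abs_arg_lt_pi_div_two_iff.2 (Or.inl hre)).trans (by linarith [Real.pi_pos])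
    obtain ⟨D, hD, h⟩ := hasDerivAt_normalizedMoment hN₀ hN₁ hN him
    rw [exp_log hne] at h
    have hlog := ((hasDerivAt_id y).const_sub 1).clog (Or.inl hre : (1 - id y) ∈ slitPlane)
    have hco : HasDerivAt (fun y => normalizedMoment N₀ N₁ (log (1 - y))) (D * (-1 / (1 - y))) y :=
      HasDerivAt.comp (h₂ := normalizedMoment N₀ N₁) y hD hlog
    refine ⟨_, hco, ?_⟩
    field_simp
    linear_combination -h
  have hd : DifferentiableOn ℂ (fun y => normalizedMoment N₀ N₁ (log (1 - y)))
      (Metric.ball 0 1) := fun y hy =>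
    (hder y hy).choose_spec.1.differentiableAt.differentiableWithinAt
  have key := eq_ordinaryHypergeometric_of_ode (b := N₀ + 1) (c := N₀ + N₁ + 2)
    (by simp only [add_re, re_ofNat] at hN ⊢; linarith) hd (fun y hy => by
      obtain ⟨D, hD, h⟩ := hder y hy
      rw [hD.deriv, h]) h1
  rw [← key, sub_sub_cancel, log_exp (abs_lt.1 hm).1 (abs_lt.1 hm).2.le]

/-- The continuation of the hypergeometric function. -/
theorem exists_hypergeometric_continuation (hN₀ : -1 < N₀.re) (hN₁ : -1 < N₁.re)
    (hN : -1 < (N₀ + N₁).re) : ∃ Φ : ℂ → ℂ, DifferentiableOn ℂ Φ ratioDomain ∧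
      ∀ l ∈ ratioDomain, |l.im - Real.pi| < Real.pi →
        Φ l = normalizedMoment N₀ N₁ (l - Real.pi * I) := by
  -- The homogeneous solution is (1 + e^l)^{-(N₀+N₁+1)} e^{N₁ l}, from the moment equation at m = l
  -- - πi, where 1 - e^m = 1 + e^l.
  let A : ℂ → ℂ := fun l => -(N₀ + N₁ + 1) * log (1 + exp l) + N₁ * l
  have hA : ∀ l ∈ ratioDomain,
      HasDerivAt A (-(N₀ + N₁ + 1) * (exp l / (1 + exp l)) + N₁) l := fun l hl => by
    have h1 := ((hasDerivAt_exp l).const_add 1).clog hl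
    exact ((h1.const_mul (-(N₀ + N₁ + 1))).add ((hasDerivAt_id l).const_mul N₁)).congr_deriv (by simp)
  have hdiff : DifferentiableOn ℂ (fun l => -((N₀ + N₁ + 1) / (1 + exp l)) * exp (-A l))
      ratioDomain := fun l hl => by
    have h1 : DifferentiableAt ℂ A l := (hA l hl).differentiableAt
    have h2 := one_add_exp_ne_zero hl
    exact (by fun_prop (disch := assumption) : DifferentiableAt ℂ _ l).differentiableWithinAt
  obtain ⟨P, hP⟩ := exists_primitive_of_sub_mem isOpen_ratioDomain sub_mem_ratioDomain
    re_neg_subset_ratioDomain hdiff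
  -- A point of the strip 0 < Im l < 2π where m = -1; the solution is matched with the moment there.
  let l₀ : ℂ := -1 + Real.pi * I
  have hl₀ : l₀ ∈ ratioDomain := re_neg_subset_ratioDomain (by simp [l₀])
  let Φ : ℂ → ℂ := fun l =>
    exp (A l) * (P l - P l₀ + exp (-A l₀) * normalizedMoment N₀ N₁ (l₀ - Real.pi * I))
  have hΦ : ∀ l ∈ ratioDomain, HasDerivAt Φ ((-(N₀ + N₁ + 1) * (exp l / (1 + exp l)) + N₁) * Φ l +
      -((N₀ + N₁ + 1) / (1 + exp l))) l := fun l hl => by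
    refine ((hA l hl).cexp.mul (((hP l hl).sub_const _).add_const _)).congr_deriv ?_
    have : exp (A l) * exp (-A l) = 1 := by rw [← exp_add, add_neg_cancel, exp_zero]
    simp only [Φ]
    linear_combination (-((N₀ + N₁ + 1) / (1 + exp l))) * this
  refine ⟨Φ, fun l hl => (hΦ l hl).differentiableAt.differentiableWithinAt, fun l hl him => ?_⟩
  refine eqOn_of_linear_ode (g₂ := fun l => normalizedMoment N₀ N₁ (l - Real.pi * I))
    (isOpen_ratioDomain.inter (isOpen_strip Real.pi Real.pi))
    (isPreconnected_ratioDomain_inter_strip _ _) (fun l hl => hA l hl.1)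
    (fun l hl => hΦ l hl.1) (fun l hl => ?_) (w₀ := l₀)
    ⟨hl₀, by simpa [l₀] using Real.pi_pos⟩ ?_ ⟨hl, him⟩
  · obtain ⟨D, hD, h⟩ := hasDerivAt_normalizedMoment hN₀ hN₁ hN (m := l - Real.pi * I)
      (by simpa using hl.2)
    refine (hD.comp_sub_const l _).congr_deriv ?_
    have h2 := one_add_exp_ne_zero hl.1
    rw [exp_sub, exp_pi_mul_I, div_neg, div_one, sub_neg_eq_add] at h
    field_simp
    linear_combination h
  · simp only [Φ, sub_self, zero_add]
    rw [← mul_assoc, ← exp_add, add_neg_cancel, exp_zero, one_mul]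

/-- The analytic continuation of the hypergeometric function exists, and is the normalized moment. -/
theorem hypergeometric_isAnalyticContinuation (hN₀ : -1 < N₀.re) (hN₁ : -1 < N₁.re)
    (hN : -1 < (N₀ + N₁).re) :
    IsAnalyticContinuation
      (fun l => ordinaryHypergeometric 1 (N₀ + 1) (N₀ + N₁ + 2) (1 + exp l)) hypergeometricBase
      ratioDomain (hypergeometricOneAdd 1 (N₀ + 1) (N₀ + N₁ + 2)) ∧
    ∀ l ∈ ratioDomain, |l.im - Real.pi| < Real.pi →
      hypergeometricOneAdd 1 (N₀ + 1) (N₀ + N₁ + 2) l =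
        normalizedMoment N₀ N₁ (l - Real.pi * I) := by
  obtain ⟨Φ, hΦ, hM⟩ := exists_hypergeometric_continuation hN₀ hN₁ hN
  have hpi := Real.pi_pos
  have hc : IsAnalyticContinuation
      (fun l => ordinaryHypergeometric 1 (N₀ + 1) (N₀ + N₁ + 2) (1 + exp l)) hypergeometricBase
      ratioDomain Φ := by
    refine ⟨?_, ⟨-1 + Real.pi * I, re_neg_subset_ratioDomain (by simp), ?_, ?_, ?_⟩,
      fun l hl => hl.1, isOpen_ratioDomain, isPreconnected_ratioDomain, hΦ, fun l hl => ?_⟩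
    · exact isOpen_ratioDomain.inter ((isOpen_lt continuous_const continuous_im).inter
        ((isOpen_lt continuous_im continuous_const).inter
          (isOpen_lt (f := fun l : ℂ => ‖1 + exp l‖) (by fun_prop) continuous_const)))
    · simpa using hpi
    · simp; linarith
    · rw [exp_add, exp_pi_mul_I, mul_neg_one, ← sub_eq_add_neg, ← ofReal_one, ← ofReal_neg,
        ← ofReal_exp, ← ofReal_sub, norm_real, Real.norm_eq_abs, abs_lt]
      have h1 := Real.exp_pos (-1)
      have h2 : Real.exp (-1) < 1 := by simp
      constructor <;> linarith
    · obtain ⟨h1, h2, h3, h4⟩ := hl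
      have him : |l.im - Real.pi| < Real.pi := abs_lt.2 ⟨by linarith, by linarith⟩
      have he : exp (l - Real.pi * I) = -exp l := by
        rw [exp_sub, exp_pi_mul_I, div_neg, div_one]
      rw [hM l h1 him, normalizedMoment_eq_ordinaryHypergeometric hN₀ hN₁ hN
        (by simpa using him) (by rwa [he, sub_neg_eq_add]), he, sub_neg_eq_add]
  have hc' : IsAnalyticContinuation
      (fun l => ordinaryHypergeometric 1 (N₀ + 1) (N₀ + N₁ + 2) (1 + exp l)) hypergeometricBase
      ratioDomain (hypergeometricOneAdd 1 (N₀ + 1) (N₀ + N₁ + 2)) :=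
    Classical.epsilon_spec ⟨Φ, hc⟩
  exact ⟨hc', fun l hl him => (hc'.unique hc hl).trans (hM l hl him)⟩

end hypergeometric

/-! ### The tail integral: convergence, independence of direction, holomorphy -/

/-- The integral of `f` along the vertical segment from `w` to `w.re + ω i` and then along the
horizontal ray to the right. -/
noncomputable def angularIntegral (f : ℂ → ℂ) (w : ℂ) (ω : ℝ) : ℂ :=
  (∫ θ in w.im..ω, f (w.re + θ * I) * I) + ∫ x in Ioi w.re, f (x + ω * I)

theorem hasDerivAt_comp_ofReal_add_mul_I {F f : ℂ → ℂ} (hF : ∀ z, HasDerivAt F (f z) z) (x ω : ℝ) :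
    HasDerivAt (fun x : ℝ => F (x + ω * I)) (f (x + ω * I)) x := by
  have h : HasDerivAt (fun x : ℝ => (x : ℂ) + ω * I) 1 x :=
    ((hasDerivAt_id x).ofReal_comp).add_const _
  simpa using! (hF _).comp x h

theorem hasDerivAt_comp_add_ofReal_mul_I {F f : ℂ → ℂ} (hF : ∀ z, HasDerivAt F (f z) z) (x θ : ℝ) :
    HasDerivAt (fun θ : ℝ => F (x + θ * I)) (f (x + θ * I) * I) θ := by
  have h : HasDerivAt (fun θ : ℝ => (x : ℂ) + θ * I) I θ := by
    simpa using! (((hasDerivAt_id θ).ofReal_comp).mul_const I).const_add (x : ℂ)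
  exact (hF _).comp θ h

/-- Since `f` is entire, an integral to infinity is a limit of a primitive along the ray; comparing
paths becomes comparing such limits. -/
theorem tendsto_primitive_angularIntegral {F f : ℂ → ℂ} (hF : ∀ z, HasDerivAt F (f z) z)
    (hf : Continuous f) {w : ℂ} {ω : ℝ}
    (hi : IntegrableOn (fun x : ℝ => f (x + ω * I)) (Ioi w.re)) :
    Tendsto (fun x : ℝ => F (x + ω * I)) atTop (𝓝 (F w + angularIntegral f w ω)) := by
  have h1 : (∫ θ in w.im..ω, f (w.re + θ * I) * I) = F (w.re + ω * I) - F w := by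
    rw [intervalIntegral.integral_eq_sub_of_hasDerivAt
      (fun θ _ => hasDerivAt_comp_add_ofReal_mul_I hF w.re θ)
      (Continuous.intervalIntegrable (by fun_prop) _ _), re_add_im]
  have h2 := intervalIntegral_tendsto_integral_Ioi w.re hi tendsto_id
  have h3 : ∀ x : ℝ, (∫ t in w.re..x, f (t + ω * I)) = F (x + ω * I) - F (w.re + ω * I) := fun x =>
    intervalIntegral.integral_eq_sub_of_hasDerivAt
      (fun t _ => hasDerivAt_comp_ofReal_add_mul_I hF t ω)
      (Continuous.intervalIntegrable (by fun_prop) _ _)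
  simp only [id, h3] at h2
  have h4 := h2.add_const (F (w.re + ω * I))
  simp only [sub_add_cancel] at h4
  convert h4 using 2
  rw [angularIntegral, h1]
  ring

theorem integrableOn_exp_neg_mul_exp {ρ : ℝ} (hρ : 0 < ρ) (r x₀ : ℝ) :
    IntegrableOn (fun x => Real.exp (-ρ * Real.exp x) * Real.exp (-r * x)) (Ioi x₀) := by
  refine integrable_of_isBigO_exp_neg one_pos (by fun_prop) ?_
  have h1 := (tendsto_rpow_mul_exp_neg_mul_atTop_nhds_zero (1 - r) _ hρ).comp
    Real.tendsto_exp_atTop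
  refine Asymptotics.IsBigO.of_bound 1 ?_
  filter_upwards [h1.eventually (gt_mem_nhds one_pos)] with x hx
  rw [Real.norm_of_nonneg (by positivity), Real.norm_of_nonneg (by positivity), one_mul]
  simp only [Function.comp, ← Real.exp_mul] at hx
  have h2 : Real.exp (-r * x) = Real.exp (x * (1 - r)) * Real.exp (-1 * x) := by
    rw [← Real.exp_add]; congr 1; ring
  rw [h2]
  nlinarith [Real.exp_pos (-1 * x)]

theorem tendsto_exp_neg_mul_exp {ρ : ℝ} (hρ : 0 < ρ) (r : ℝ) :
    Tendsto (fun x => Real.exp (-ρ * Real.exp x) * Real.exp (-r * x)) atTop (𝓝 0) := by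
  refine ((tendsto_rpow_mul_exp_neg_mul_atTop_nhds_zero (-r) _ hρ).comp
    Real.tendsto_exp_atTop).congr fun x => ?_
  simp only [Function.comp, ← Real.exp_mul]
  rw [mul_comm]; congr 2; ring

/-- The integrand of the tail integral, in the variable `log (σ₀ t)`. -/
noncomputable def scaledTail (n a l ξ : ℂ) : ℂ :=
  exp (-((1 + exp l) * exp ξ + n * ξ)) * entireStieltjes a ξ

section scaledTail

variable {n a : ℂ}

theorem continuous_scaledTail (ha : 0 < a.re) :
    Continuous fun q : ℂ × ℂ => scaledTail n a q.1 q.2 := by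
  have := (differentiable_entireStieltjes ha).continuous
  unfold scaledTail
  fun_prop

theorem differentiable_scaledTail (ha : 0 < a.re) (l : ℂ) : Differentiable ℂ (scaledTail n a l) := by
  have := differentiable_entireStieltjes ha
  unfold scaledTail
  fun_prop

/-- A closed range of directions shorter than π inside (-3π/2, 3π/2) fits into one strip of
half-width below π about some |β| < π/2, where the rotated bound applies. -/
theorem exists_norm_scaledTail_le (ha : 0 < a.re) {ω₁ ω₂ : ℝ}
    (h1 : -(3 * Real.pi / 2) < ω₁) (h2 : ω₂ < 3 * Real.pi / 2) (h : ω₂ - ω₁ < Real.pi) :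
    ∃ C, 0 ≤ C ∧ ∀ θ ∈ Icc ω₁ ω₂, ∀ (l : ℂ) (x ρ : ℝ), ρ ≤ ((1 + exp l) * exp (θ * I)).re →
      ‖scaledTail n a l (x + θ * I)‖ ≤
        C * (Real.exp (-ρ * Real.exp x) * Real.exp (-(n.re + 1) * x)) := by
  have hpi := Real.pi_pos
  obtain ⟨β, hβ1, hβ2⟩ : ∃ β, max (ω₂ - Real.pi) (-(Real.pi / 2)) < β ∧
      β < min (ω₁ + Real.pi) (Real.pi / 2) := by
    refine exists_between (max_lt ?_ ?_) <;> refine lt_min ?_ ?_ <;> linarith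
  obtain ⟨hβ3, hβ4⟩ := max_lt_iff.1 hβ1
  obtain ⟨hβ5, hβ6⟩ := lt_min_iff.1 hβ2
  obtain ⟨C, hC0, hC⟩ := exists_norm_entireStieltjes_le ha (β := β)
    (δ := max (ω₂ - β) (β - ω₁)) (abs_lt.2 ⟨hβ4, hβ6⟩) (max_lt (by linarith) (by linarith))
  -- The extra factor bounds the contribution of Im n to |e^{-nξ}| over the given range of
  -- directions.
  refine ⟨C * Real.exp (|n.im| * max |ω₁| |ω₂|), by positivity, fun θ hθ l x ρ hρ => ?_⟩
  have hg := hC (x + θ * I) (by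
    simp only [add_im, ofReal_im, mul_im, ofReal_re, I_im, mul_one, I_re, mul_zero, add_zero,
      zero_add]
    refine abs_le.2 ⟨?_, ?_⟩
    · linarith [le_max_right (ω₂ - β) (β - ω₁), hθ.1]
    · linarith [le_max_left (ω₂ - β) (β - ω₁), hθ.2])
  have hre : (x + θ * I : ℂ).re = x := by simp
  rw [hre] at hg
  have hn : ‖exp (-((1 + exp l) * exp (x + θ * I) + n * (x + θ * I)))‖ ≤
      Real.exp (-ρ * Real.exp x) * Real.exp (-n.re * x) *
        Real.exp (|n.im| * max |ω₁| |ω₂|) := by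
    rw [norm_exp, ← Real.exp_add, ← Real.exp_add, Real.exp_le_exp, neg_re, add_re, re_mul_exp_ray]
    have e : (n * (x + θ * I)).re = n.re * x - n.im * θ := by simp
    rw [e]
    have h3 : n.im * θ ≤ |n.im| * max |ω₁| |ω₂| := by
      refine (le_abs_self _).trans ?_
      rw [abs_mul]
      gcongr
      exact abs_le_max_abs_abs hθ.1 hθ.2
    have h4 := mul_le_mul_of_nonneg_right hρ (Real.exp_pos x).le
    linarith
  rw [scaledTail, norm_mul]
  refine (mul_le_mul hn hg (norm_nonneg _) (by positivity)).trans (le_of_eq ?_)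
  have e1 : Real.exp (-(n.re + 1) * x) = Real.exp (-n.re * x) * Real.exp (-x) := by
    rw [← Real.exp_add]; congr 1; ring
  rw [e1]; ring

theorem mul_exp_mul_I_re_pos {l : ℂ} (hl : l ∈ ratioDomain) {ω : ℝ}
    (hω : |ω + (1 + exp l).arg| < Real.pi / 2) : 0 < ((1 + exp l) * exp (ω * I)).re := by
  nth_rw 1 [← exp_log (one_add_exp_ne_zero hl)]
  rw [← exp_add]
  refine re_exp_pos ?_
  simpa [log_im, add_comm] using hω

theorem abs_lt_of_abs_add_arg {l : ℂ} {ω : ℝ}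
    (hω : |ω + (1 + exp l).arg| < Real.pi / 2) :
    -(3 * Real.pi / 2) < ω ∧ ω < 3 * Real.pi / 2 := by
  obtain ⟨h3, h4⟩ := abs_lt.1 hω
  constructor <;> linarith [neg_pi_lt_arg (1 + exp l), arg_le_pi (1 + exp l)]

theorem integrableOn_scaledTail (ha : 0 < a.re) {l : ℂ} (hl : l ∈ ratioDomain) {ω : ℝ}
    (hω : |ω + (1 + exp l).arg| < Real.pi / 2) (x₀ : ℝ) :
    IntegrableOn (fun x : ℝ => scaledTail n a l (x + ω * I)) (Ioi x₀) := by
  obtain ⟨h1, h2⟩ := abs_lt_of_abs_add_arg hω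
  obtain ⟨C, -, hC⟩ := exists_norm_scaledTail_le (n := n) ha h1 h2 (by linarith [Real.pi_pos])
  refine ((integrableOn_exp_neg_mul_exp (mul_exp_mul_I_re_pos hl hω) (n.re + 1) x₀).const_mul
    C).mono' ?_ (Eventually.of_forall fun x => hC ω ⟨le_rfl, le_rfl⟩ l x _ le_rfl)
  have := (differentiable_scaledTail (n := n) ha l).continuous
  exact (by fun_prop : Continuous fun x : ℝ =>
    scaledTail n a l (x + ω * I)).aestronglyMeasurable

theorem exists_primitive_scaledTail (n : ℂ) (ha : 0 < a.re) (l : ℂ) :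
    ∃ F : ℂ → ℂ, ∀ z, HasDerivAt F (scaledTail n a l z) z := by
  obtain ⟨F, hF⟩ := (differentiable_scaledTail (n := n) ha l).isExactOn_univ
  exact ⟨F, fun z => hF z (mem_univ z)⟩

/-- The two limits of the primitive differ by an integral over a vertical segment of fixed length,
on which the integrand decays doubly exponentially. -/
theorem angularIntegral_scaledTail_eq_of_le (ha : 0 < a.re) {l : ℂ} (hl : l ∈ ratioDomain)
    {ω₁ ω₂ : ℝ} (h12 : ω₁ ≤ ω₂) (h1 : |ω₁ + (1 + exp l).arg| < Real.pi / 2)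
    (h2 : |ω₂ + (1 + exp l).arg| < Real.pi / 2) (w : ℂ) :
    angularIntegral (scaledTail n a l) w ω₁ = angularIntegral (scaledTail n a l) w ω₂ := by
  obtain ⟨F, hF⟩ := exists_primitive_scaledTail n ha l
  have hcont := (differentiable_scaledTail (n := n) ha l).continuous
  have t1 := tendsto_primitive_angularIntegral hF hcont (integrableOn_scaledTail ha hl h1 w.re)
  have t2 := tendsto_primitive_angularIntegral hF hcont (integrableOn_scaledTail ha hl h2 w.re)
  obtain ⟨C, hC0, hC⟩ := exists_norm_scaledTail_le (n := n) ha (abs_lt_of_abs_add_arg h1).1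
    (abs_lt_of_abs_add_arg h2).2 (by linarith [(abs_lt.1 h1).1, (abs_lt.1 h2).2])
  -- The least rate of decay between the two directions is attained, hence positive; it serves the
  -- whole segment.
  obtain ⟨θ₀, hθ₀, hmin⟩ := isCompact_Icc.exists_isMinOn (nonempty_Icc.2 h12)
    (f := fun θ : ℝ => ((1 + exp l) * exp (θ * I)).re) (by fun_prop)
  set ρ := ((1 + exp l) * exp (θ₀ * I)).re with hρ
  have hρ0 : 0 < ρ := mul_exp_mul_I_re_pos hl (abs_lt.2
    ⟨by linarith [(abs_lt.1 h1).1, hθ₀.1], by linarith [(abs_lt.1 h2).2, hθ₀.2]⟩)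
  have hdiff : Tendsto (fun x : ℝ => F (x + ω₂ * I) - F (x + ω₁ * I)) atTop (𝓝 0) := by
    have := ((tendsto_exp_neg_mul_exp hρ0 (n.re + 1)).const_mul C).mul_const (ω₂ - ω₁)
    rw [mul_zero, zero_mul] at this
    refine squeeze_zero_norm (fun x => ?_) this
    refine norm_image_sub_le_of_norm_deriv_le_segment' (f := fun θ : ℝ => F (x + θ * I))
      (fun θ _ => (hasDerivAt_comp_add_ofReal_mul_I hF x θ).hasDerivWithinAt)
      (fun θ hθ => ?_) ω₂ (right_mem_Icc.2 h12)
    rw [norm_mul, norm_I, mul_one]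
    exact hC θ ⟨hθ.1, hθ.2.le⟩ l x ρ (hmin ⟨hθ.1, hθ.2.le⟩)
  have := tendsto_nhds_unique hdiff (t2.sub t1)
  linear_combination this

theorem angularIntegral_scaledTail_eq (ha : 0 < a.re) {l : ℂ} (hl : l ∈ ratioDomain)
    {ω₁ ω₂ : ℝ} (h1 : |ω₁ + (1 + exp l).arg| < Real.pi / 2)
    (h2 : |ω₂ + (1 + exp l).arg| < Real.pi / 2) (w : ℂ) :
    angularIntegral (scaledTail n a l) w ω₁ = angularIntegral (scaledTail n a l) w ω₂ := by
  rcases le_total ω₁ ω₂ with h | h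
  · exact angularIntegral_scaledTail_eq_of_le ha hl h h1 h2 w
  · exact (angularIntegral_scaledTail_eq_of_le ha hl h h2 h1 w).symm

theorem abs_neg_arg_add_arg (z : ℂ) : |-z.arg + z.arg| < Real.pi / 2 := by
  rw [neg_add_cancel, abs_zero]; linarith [Real.pi_pos]

/-- The tail integral, along the direction of steepest descent. -/
noncomputable def tailIntegral (n a w l : ℂ) : ℂ :=
  angularIntegral (scaledTail n a l) w (-(1 + exp l).arg)

theorem exists_tailIntegral_add_primitive (n : ℂ) (ha : 0 < a.re) {l : ℂ} (hl : l ∈ ratioDomain) :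
    ∃ (F : ℂ → ℂ) (L : ℂ), (∀ z, HasDerivAt F (scaledTail n a l z) z) ∧
      (∀ w, tailIntegral n a w l = L - F w) ∧
      Tendsto (fun x : ℝ => F (x + (-(1 + exp l).arg : ℝ) * I)) atTop (𝓝 L) := by
  obtain ⟨F, hF⟩ := exists_primitive_scaledTail n ha l
  have hcont := (differentiable_scaledTail (n := n) ha l).continuous
  have t := fun w : ℂ => tendsto_primitive_angularIntegral hF hcont
    (integrableOn_scaledTail ha hl (abs_neg_arg_add_arg _) w.re)
  exact ⟨F, _, hF, fun w => eq_sub_of_add_eq' (tendsto_nhds_unique (t w) (t 0)), t 0⟩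

theorem hasDerivAt_tailIntegral (ha : 0 < a.re) {l : ℂ} (hl : l ∈ ratioDomain) (w : ℂ) :
    HasDerivAt (fun w => tailIntegral n a w l) (-scaledTail n a l w) w := by
  obtain ⟨F, L, hF, hL, -⟩ := exists_tailIntegral_add_primitive n ha hl
  simp only [hL]
  exact (hF w).const_sub L

theorem tendsto_tailIntegral (ha : 0 < a.re) {l : ℂ} (hl : l ∈ ratioDomain) :
    Tendsto (fun x : ℝ => tailIntegral n a (x + (-(1 + exp l).arg : ℝ) * I) l) atTop (𝓝 0) := by
  obtain ⟨F, L, -, hL, ht⟩ := exists_tailIntegral_add_primitive n ha hl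
  simp only [hL]
  simpa using ht.const_sub L

/-- The steepest direction moves with l, and not holomorphically. Freezing it at its value for l₀
leaves the integral unchanged for nearby l, and differentiation under the integral applies. -/
theorem differentiableAt_tailIntegral_right (ha : 0 < a.re) {l₀ : ℂ} (hl₀ : l₀ ∈ ratioDomain)
    (w : ℂ) : DifferentiableAt ℂ (tailIntegral n a w) l₀ := by
  set ω : ℝ := -(1 + exp l₀).arg with hω
  have hω₀ : |ω + (1 + exp l₀).arg| < Real.pi / 2 := abs_neg_arg_add_arg _
  have hcont : ContinuousAt (fun l => (1 + exp l).arg) l₀ :=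
    (continuousAt_arg hl₀).comp (f := fun l => 1 + exp l) (by fun_prop)
  have hev : tailIntegral n a w =ᶠ[𝓝 l₀] fun l => angularIntegral (scaledTail n a l) w ω := by
    have h1 : ∀ᶠ l in 𝓝 l₀, |ω + (1 + exp l).arg| < Real.pi / 2 :=
      ((continuousAt_const.add hcont).abs).eventually_lt_const hω₀
    filter_upwards [h1, isOpen_ratioDomain.mem_nhds hl₀] with l hl hlD
    exact angularIntegral_scaledTail_eq ha hlD (abs_neg_arg_add_arg _) hl w
  refine DifferentiableAt.congr_of_eventuallyEq ?_ hev
  have hdiff : ∀ ξ : ℂ, Differentiable ℂ fun l => scaledTail n a l ξ := fun ξ => by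
    unfold scaledTail; fun_prop
  have hc2 := continuous_scaledTail (n := n) ha
  refine DifferentiableAt.add ?_ ?_
  · simp only [intervalIntegral.intervalIntegral_eq_integral_uIoc]
    refine DifferentiableAt.const_smul ?_ _
    obtain ⟨M, hM⟩ := ((isCompact_closedBall l₀ 1).prod (isCompact_uIcc (a := w.im) (b := ω))
      ).exists_bound_of_continuousOn
      (f := fun q : ℂ × ℝ => scaledTail n a q.1 (w.re + q.2 * I) * I) (by
        exact (((hc2.comp (by fun_prop : Continuous fun q : ℂ × ℝ =>
          (q.1, (w.re + q.2 * I : ℂ))))).mul continuous_const).continuousOn)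
    refine (hasDerivAt_integral_of_differentiableOn_of_norm_le
      (μ := volume.restrict (uIoc w.im ω))
      (f := fun l (θ : ℝ) => scaledTail n a l (w.re + θ * I) * I) (b := fun _ => M)
      (Metric.closedBall_mem_nhds l₀ one_pos) (fun l _ => ?_)
      (Eventually.of_forall fun θ => ((hdiff _).mul_const I).differentiableOn)
      ((ae_restrict_iff' measurableSet_uIoc).2 (Eventually.of_forall fun θ hθ l hl =>
        hM (l, θ) ⟨hl, uIoc_subset_uIcc hθ⟩)) ?_).2.differentiableAt
    · have := (differentiable_scaledTail (n := n) ha l).continuous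
      exact (by fun_prop : Continuous fun θ : ℝ =>
        scaledTail n a l (w.re + θ * I) * I).aestronglyMeasurable
    · exact integrableOn_const measure_Ioc_lt_top.ne
  · obtain ⟨h1, h2⟩ := abs_lt_of_abs_add_arg hω₀
    obtain ⟨C, -, hC⟩ := exists_norm_scaledTail_le (n := n) ha h1 h2 (by linarith [Real.pi_pos])
    have hρ := mul_exp_mul_I_re_pos hl₀ hω₀
    set ρ := ((1 + exp l₀) * exp (ω * I)).re with hρdef
    -- Halving the rate of decay at l₀ gives a bound valid in a neighbourhood.
    have hU : {l : ℂ | ρ / 2 < ((1 + exp l) * exp (ω * I)).re} ∈ 𝓝 l₀ :=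
      (isOpen_lt continuous_const (by fun_prop)).mem_nhds
        (by simp only [mem_ofPred_eq]; linarith)
    refine (hasDerivAt_integral_of_differentiableOn_of_norm_le
      (μ := volume.restrict (Ioi w.re))
      (f := fun l (x : ℝ) => scaledTail n a l (x + ω * I)) hU (fun l _ => ?_)
      (Eventually.of_forall fun x => (hdiff _).differentiableOn)
      (Eventually.of_forall fun x l hl => hC ω ⟨le_rfl, le_rfl⟩ l x (ρ / 2) (le_of_lt hl))
      ((integrableOn_exp_neg_mul_exp (half_pos hρ) (n.re + 1) w.re).const_mul C)).2.differentiableAt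
    have := (differentiable_scaledTail (n := n) ha l).continuous
    exact (by fun_prop : Continuous fun x : ℝ =>
      scaledTail n a l (x + ω * I)).aestronglyMeasurable

theorem differentiableAt_tailIntegral (ha : 0 < a.re) {q : ℂ × ℂ} (hq : q.2 ∈ ratioDomain) :
    DifferentiableAt ℂ (fun q : ℂ × ℂ => tailIntegral n a q.1 q.2) q := by
  refine differentiableAt_of_partial (f₁ := fun q => -scaledTail n a q.2 q.1) ?_ ?_
    (differentiableAt_tailIntegral_right ha hq q.1)
  · filter_upwards [continuousAt_snd.preimage_mem_nhds (isOpen_ratioDomain.mem_nhds hq)] with p hp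
    exact hasDerivAt_tailIntegral ha hp p.1
  · exact ((continuous_scaledTail ha).comp continuous_swap).neg.continuousAt

end scaledTail

/-! ### The normalized second hyperterminant -/

/-- The normalized second hyperterminant, as a function of `log (σ₀ z)` and `log (σ₁ / σ₀)`. -/
noncomputable def scaledSecond (N₀ N₁ w l : ℂ) : ℂ :=
  Gamma (N₀ + 1) * Gamma (N₁ + 1) / Gamma (N₀ + N₁ + 2) *
      hypergeometricOneAdd 1 (N₀ + 1) (N₀ + N₁ + 2) l * (1 + exp l) *
      entireStieltjes (N₀ + N₁ + 1) (w + log (1 + exp l)) +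
    Gamma (N₁ + 1) * exp ((1 + exp l) * exp w + (N₀ + N₁) * w) *
      tailIntegral (N₀ + N₁) (N₀ + 1) w l

section

variable {N₀ N₁ : ℂ}

theorem re_add_one_pos {N : ℂ} (hN : -1 < N.re) : 0 < (N + 1).re := by
  simp only [add_re, one_re]; linarith

/-- Identifies the hypergeometric coefficient as M / Γ(N₀+N₁+1), the multiple of S_{N₀+N₁+1} that
cancels the moment term in the equation for T. -/
theorem coefficient_mul_hypergeometric_eq (hN₀ : -1 < N₀.re) (hN₁ : -1 < N₁.re)
    (hN : -1 < (N₀ + N₁).re) {l : ℂ} (hl : l ∈ ratioDomain) (him : |l.im - Real.pi| < Real.pi) :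
    Gamma (N₀ + 1) * Gamma (N₁ + 1) / Gamma (N₀ + N₁ + 2) *
      hypergeometricOneAdd 1 (N₀ + 1) (N₀ + N₁ + 2) l * Gamma (N₀ + N₁ + 1) =
      innerMoment N₀ N₁ (l - Real.pi * I) := by
  rw [(hypergeometric_isAnalyticContinuation hN₀ hN₁ hN).2 l hl him, normalizedMoment,
    show N₀ + N₁ + 2 = N₀ + N₁ + 1 + 1 by ring, Gamma_add_one _ (add_one_ne_zero_of_re hN)]
  have h0 := Gamma_add_one_ne_zero hN₀
  have h1 := Gamma_add_one_ne_zero hN₁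
  have h2 := Gamma_add_one_ne_zero hN
  have h3 := add_one_ne_zero_of_re hN
  field_simp

/-- The normalized second hyperterminant agrees with the Stieltjes transform that represents it on
the principal branch. -/
theorem stieltjes_innerKernel_eq (hN₀ : -1 < N₀.re) (hN₁ : -1 < N₁.re)
    (hN : -1 < (N₀ + N₁).re) {w l : ℂ} (hl : l ∈ ratioDomain) (him : |l.im - Real.pi| < Real.pi)
    (hw : |w.im| < Real.pi) :
    stieltjes (innerKernel N₀ N₁ (l - Real.pi * I)) w = scaledSecond N₀ N₁ w l := by
  have hm : |(l - Real.pi * I).im| < Real.pi := by simpa using him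
  have hexp : 1 - exp (l - Real.pi * I) = 1 + exp l := by
    rw [exp_sub, exp_pi_mul_I, div_neg, div_one, sub_neg_eq_add]
  have hlog := exp_log (one_add_exp_ne_zero hl)
  have hcoef := coefficient_mul_hypergeometric_eq hN₀ hN₁ hN hl him
  set B := Gamma (N₀ + 1) * Gamma (N₁ + 1) / Gamma (N₀ + N₁ + 2) *
      hypergeometricOneAdd 1 (N₀ + 1) (N₀ + N₁ + 2) l with hB
  set y := 1 + exp l with hy
  let A : ℂ → ℂ := fun w => y * exp w + (N₀ + N₁) * w
  -- The claimed identity divided by the homogeneous solution; both sides solve the same equation,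
  -- so `D` is constant.
  let D : ℂ → ℂ := fun w => exp (-A w) * (stieltjes (innerKernel N₀ N₁ (l - Real.pi * I)) w -
    B * y * entireStieltjes (N₀ + N₁ + 1) (w + log y)) -
    Gamma (N₁ + 1) * tailIntegral (N₀ + N₁) (N₀ + 1) w l
  have hD : ∀ w ∈ {w : ℂ | |w.im - 0| < Real.pi}, HasDerivAt D 0 w := fun w hw => by
    simp only [sub_zero, mem_ofPred_eq] at hw
    have h1 := hasDerivAt_stieltjes_innerKernel hN₀ hN₁ hN hm hw
    rw [hexp, ← entireStieltjes_eq (re_add_one_pos hN₀) hw] at h1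
    have h2 := (hasDerivAt_entireStieltjes (re_add_one_pos hN) (w + log y)).comp_add_const w (log y)
    rw [exp_add, hlog] at h2
    have h3 := hasDerivAt_tailIntegral (n := N₀ + N₁) (re_add_one_pos hN₀) hl w
    refine (((hasDerivAt_mul_exp_add y (N₀ + N₁) w).neg.cexp.mul
      (h1.sub (h2.const_mul (B * y)))).sub (h3.const_mul (Gamma (N₁ + 1)))).congr_deriv ?_
    simp only [Pi.neg_apply, Pi.sub_apply, scaledTail, ← hy]
    linear_combination exp (-(y * exp w + (N₀ + N₁) * w)) * y * hcoef
  have h0 : (0 : ℂ) ∈ {w : ℂ | |w.im - 0| < Real.pi} := by simpa using Real.pi_pos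
  have hconst : ∀ x ∈ {w : ℂ | |w.im - 0| < Real.pi}, D x = D 0 := fun x hx =>
    (isOpen_strip 0 _).is_const_of_deriv_eq_zero (convex_strip 0 _).isPreconnected
      (fun w hw => (hD w hw).differentiableAt.differentiableWithinAt)
      (fun w hw => (hD w hw).deriv) hx h0
  have harg : |-y.arg| < Real.pi := by
    rw [abs_neg]
    exact abs_lt.2 ⟨neg_pi_lt_arg y, lt_of_le_of_ne (arg_le_pi y) (mem_slitPlane_iff_arg.1 hl).1⟩
  -- On this ray y e^w is positive, so the inverse homogeneous solution decays and w + log y is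
  -- real. The ray lies inside |Im w| < π because y is off the cut.
  set ω : ℝ := -y.arg with hω
  have hin : ∀ x : ℝ, (x + ω * I : ℂ).im = ω := fun x => by simp
  have hre : ∀ x : ℝ, (x + ω * I : ℂ).re = x := fun x => by simp
  have hex : Tendsto (fun x : ℝ => Real.exp (-x)) atTop (𝓝 0) :=
    Real.tendsto_exp_neg_atTop_nhds_zero
  have t1 : Tendsto (fun x : ℝ => exp (-A (x + ω * I))) atTop (𝓝 0) :=
    tendsto_exp_neg_ray (N₀ + N₁) (mul_exp_mul_I_re_pos hl (abs_neg_arg_add_arg _))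
  have t2 : Tendsto (fun x : ℝ => stieltjes (innerKernel N₀ N₁ (l - Real.pi * I)) (x + ω * I))
      atTop (𝓝 0) := by
    have := hex.const_mul ((∫ u in Ioi (0 : ℝ), ‖innerKernel N₀ N₁ (l - Real.pi * I) u‖) *
      (Real.cos (|ω| / 2))⁻¹)
    rw [mul_zero] at this
    refine squeeze_zero_norm (fun x => ?_) this
    have h := norm_stieltjes_le (integrableOn_innerKernel hN₀ hN₁ hN hm)
      (w := x + ω * I) (δ := |ω|) (by rw [hin]) harg
    rwa [hre] at h
  have t3 : Tendsto (fun x : ℝ => entireStieltjes (N₀ + N₁ + 1) (x + ω * I + log y))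
      atTop (𝓝 0) := by
    have := hex.const_mul ((∫ u in Ioi (0 : ℝ), ‖gammaKernel 1 (N₀ + N₁ + 1) u‖) *
      (Real.cos (0 / 2))⁻¹ * Real.exp (-(log y).re))
    rw [mul_zero] at this
    have him0 : ∀ x : ℝ, |(x + ω * I + log y).im| ≤ 0 := fun x => by
      rw [add_im, hin, log_im, hω, neg_add_cancel, abs_zero]
    refine squeeze_zero_norm (fun x => ?_) this
    rw [entireStieltjes_eq (re_add_one_pos hN) ((him0 x).trans_lt Real.pi_pos)]
    have h := norm_stieltjes_le (integrableOn_gammaKernel (b := 1) (by simp) (re_add_one_pos hN))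
      (him0 x) Real.pi_pos
    rwa [add_re, hre, neg_add, add_comm (-x), Real.exp_add, ← mul_assoc] at h
  have t4 := tendsto_tailIntegral (n := N₀ + N₁) (re_add_one_pos hN₀) hl
  have t5 := (t1.mul (t2.sub (t3.const_mul (B * y)))).sub (t4.const_mul (Gamma (N₁ + 1)))
  simp only [mul_zero, sub_zero] at t5
  have hD0 : D 0 = 0 := tendsto_nhds_unique (tendsto_const_nhds.congr fun x : ℝ =>
    (hconst (x + ω * I) (by simpa only [mem_ofPred_eq, hin, sub_zero] using harg)).symm) t5
  have hDw := hconst w (by simpa using hw)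
  rw [hD0] at hDw
  simp only [D] at hDw
  rw [scaledSecond, ← hB, ← hy]
  have e : exp (A w) * exp (-A w) = 1 := by rw [← exp_add, add_neg_cancel, exp_zero]
  change _ = _ + Gamma (N₁ + 1) * exp (A w) * _
  linear_combination exp (A w) * hDw - (stieltjes (innerKernel N₀ N₁ (l - Real.pi * I)) w -
    B * y * entireStieltjes (N₀ + N₁ + 1) (w + log y)) * e

theorem differentiableAt_scaledSecond (hN₀ : -1 < N₀.re) (hN₁ : -1 < N₁.re)
    (hN : -1 < (N₀ + N₁).re) {q : ℂ × ℂ} (hq : q.2 ∈ ratioDomain) :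
    DifferentiableAt ℂ (fun q : ℂ × ℂ => scaledSecond N₀ N₁ q.1 q.2) q := by
  have h1 : DifferentiableAt ℂ (fun q : ℂ × ℂ =>
      hypergeometricOneAdd 1 (N₀ + 1) (N₀ + N₁ + 2) q.2) q :=
    ((hypergeometric_isAnalyticContinuation hN₀ hN₁ hN).1.differentiableOn.differentiableAt
      (isOpen_ratioDomain.mem_nhds hq)).comp q differentiableAt_snd
  have h2 := differentiableAt_tailIntegral (n := N₀ + N₁) (re_add_one_pos hN₀) hq
  have h3 : DifferentiableAt ℂ (fun q : ℂ × ℂ => log (1 + exp q.2)) q :=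
    (by fun_prop : DifferentiableAt ℂ (fun q : ℂ × ℂ => 1 + exp q.2) q).clog hq
  have h4 : DifferentiableAt ℂ (fun q : ℂ × ℂ =>
      entireStieltjes (N₀ + N₁ + 1) (q.1 + log (1 + exp q.2))) q :=
    (differentiable_entireStieltjes (re_add_one_pos hN) _).comp q (differentiableAt_fst.add h3)
  unfold scaledSecond
  fun_prop

end

/-! ### Integrals along rays -/

/-- The substitution r = u/|σ|, that is τ = e^{πi} u/σ with σ = e^l, which makes e^{στ} equal to
e^{-u}. -/
theorem rayIntegral_eq (f : ℂ → ℂ) (l : ℂ) :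
    rayIntegral (Real.pi - l.im) f =
      ∫ u in Ioi (0 : ℝ), f ((Real.log u : ℂ) + (Real.pi * I - l)) * exp (Real.pi * I - l) := by
  have h := integral_comp_mul_left_Ioi' (fun r : ℝ => f ((Real.log r : ℂ) +
    ((Real.pi - l.im : ℝ) : ℂ) * I) * exp (((Real.pi - l.im : ℝ) : ℂ) * I)) 0
    (Real.exp_pos (-l.re))
  rw [mul_zero] at h
  rw [rayIntegral, ← h, ← integral_smul]
  refine setIntegral_congr_fun measurableSet_Ioi fun u hu => ?_
  have hu : (0 : ℝ) < u := hu
  have e1 : -(l.re : ℂ) + ((Real.pi - l.im : ℝ) : ℂ) * I = Real.pi * I - l := by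
    conv_rhs => rw [← re_add_im l]
    push_cast; ring
  simp only [Real.log_mul (Real.exp_ne_zero _) hu.ne', Real.log_exp]
  rw [real_smul, mul_left_comm, ofReal_exp, ← exp_add, ofReal_neg, e1, ofReal_add, ofReal_neg,
    add_comm (-(l.re : ℂ)), add_assoc, e1]

theorem exp_add_pi_mul_I_sub (u l : ℂ) : exp (u + (Real.pi * I - l)) = -(exp u * exp (-l)) := by
  rw [exp_add, exp_sub, exp_pi_mul_I, exp_neg]; ring

theorem exp_ofReal_log {u : ℝ} (hu : 0 < u) : exp (Real.log u : ℂ) = u := by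
  rw [← ofReal_exp, Real.exp_log hu]

theorem exp_mul_log_add {u : ℝ} (hu : 0 < u) (s c : ℂ) :
    exp (s * ((Real.log u : ℂ) + c)) = (u : ℂ) ^ s * exp (s * c) := by
  rw [mul_add, exp_add, cpow_def_of_ne_zero (by exact_mod_cast hu.ne'), ← ofReal_log hu.le,
    mul_comm s]

theorem firstHyperterminantIntegral_eq (a : ℂ) (p : ℂ × ℂ) :
    firstHyperterminantIntegral a p =
      exp (a * (Real.pi * I - p.2)) * exp p.2 * stieltjes (gammaKernel 1 a) (p.2 + p.1) := by
  rw [firstHyperterminantIntegral, rayIntegral_eq, stieltjes, ← integral_const_mul]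
  refine setIntegral_congr_fun measurableSet_Ioi fun u hu => ?_
  have hu : (0 : ℝ) < u := hu
  simp only [exp_mul_log_add hu, exp_add_pi_mul_I_sub, exp_ofReal_log hu, gammaKernel]
  have e1 : exp p.2 * -(u * exp (-p.2)) = -1 * u := by
    have : exp p.2 * exp (-p.2) = 1 := by rw [← exp_add, add_neg_cancel, exp_zero]
    linear_combination (-(u : ℂ)) * this
  have e2 : exp p.1 - -(u * exp (-p.2)) = exp (-p.2) * (exp (p.2 + p.1) + u) := by
    rw [mul_add, ← exp_add, neg_add_cancel_left]; ring
  have e3 : exp (a * (Real.pi * I - p.2)) =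
      exp ((a - 1) * (Real.pi * I - p.2)) * exp (Real.pi * I - p.2) := by
    rw [← exp_add]; congr 1; ring
  rw [e1, e2, e3, exp_neg]
  have := exp_ne_zero p.2
  rw [← div_div, div_inv_eq_mul]
  ring

/-- With τ₀ = -u/σ₀ and τ₁ = -v/σ₁ the denominators are (σ₀z + u)/σ₀ and (v - uσ₁/σ₀)/σ₁. The second
is a Stieltjes denominator at log u + m with e^m = -σ₁/σ₀. -/
theorem secondHyperterminantIntegral_eq (N₀ N₁ : ℂ) (p : ℂ × ℂ × ℂ) :
    secondHyperterminantIntegral N₀ N₁ p =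
      exp (N₀ * (Real.pi * I - p.2.1)) * exp (N₁ * (Real.pi * I - p.2.2)) *
        stieltjes (innerKernel N₀ N₁ (p.2.2 - p.2.1 - Real.pi * I)) (p.2.1 + p.1) := by
  obtain ⟨ζ, l₀, l₁⟩ := p
  simp only [secondHyperterminantIntegral]
  rw [rayIntegral_eq, stieltjes, ← integral_const_mul]
  refine setIntegral_congr_fun measurableSet_Ioi fun u hu => ?_
  have hu : (0 : ℝ) < u := hu
  simp only [innerKernel]
  rw [mul_div_assoc, mul_comm (gammaKernel 1 (N₀ + 1) u), rayIntegral_eq, ← integral_mul_const,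
    show ∀ A S W G : ℂ, A * (S / W * G) = A * (G / W) * S from fun A S W G => by ring]
  rw [stieltjes, ← integral_const_mul]
  refine setIntegral_congr_fun measurableSet_Ioi fun v hv => ?_
  have hv : (0 : ℝ) < v := hv
  have hX := exp_ne_zero l₀
  have hY := exp_ne_zero l₁
  have h0 : exp ((Real.log u : ℂ) + (Real.pi * I - l₀)) = -(u * (exp l₀)⁻¹) := by
    rw [exp_add_pi_mul_I_sub, exp_ofReal_log hu, exp_neg]
  have h1 : exp ((Real.log v : ℂ) + (Real.pi * I - l₁)) = -(v * (exp l₁)⁻¹) := by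
    rw [exp_add_pi_mul_I_sub, exp_ofReal_log hv, exp_neg]
  have h2 : exp ((Real.log u : ℂ) + (l₁ - l₀ - Real.pi * I)) = -(u * (exp l₁ * (exp l₀)⁻¹)) := by
    rw [exp_ofReal_log_add hu, exp_sub, exp_sub, exp_pi_mul_I]; ring
  have h3 : ∀ l : ℂ, exp (Real.pi * I - l) = -(exp l)⁻¹ := fun l => by
    rw [exp_sub, exp_pi_mul_I]; ring
  have h4 : exp (exp l₀ * -(u * (exp l₀)⁻¹) + exp l₁ * -(v * (exp l₁)⁻¹)) =
      exp (-1 * u) * exp (-1 * v) := by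
    rw [← exp_add]; congr 1; field_simp
  have h5 : exp ζ - -(u * (exp l₀)⁻¹) = (exp l₀)⁻¹ * (exp (l₀ + ζ) + u) := by
    rw [exp_add]; field_simp; ring
  have h6 : -(u * (exp l₀)⁻¹) - -(v * (exp l₁)⁻¹) =
      (exp l₁)⁻¹ * (-(u * (exp l₁ * (exp l₀)⁻¹)) + v) := by
    field_simp; ring
  simp only [gammaKernel, exp_mul_log_add hu, exp_mul_log_add hv, h0, h1, h2, h3, h4, h5, h6,
    add_sub_cancel_right, div_eq_mul_inv, mul_inv, inv_inv]
  generalize (exp (l₀ + ζ) + u)⁻¹ = W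
  generalize (-(u * (exp l₁ * (exp l₀)⁻¹)) + v : ℂ)⁻¹ = V
  field_simp

/-! ### The hyperterminants as analytic continuations -/

/-- The first hyperterminant in terms of the entire function `entireStieltjes`. -/
theorem firstHyperterminant_isAnalyticContinuation {a : ℂ} (ha : 0 < a.re) :
    IsAnalyticContinuation (firstHyperterminantIntegral a) firstPrincipalBranch univ
      (fun p => firstHyperterminant a p.1 p.2) ∧
    ∀ ζ l, firstHyperterminant a ζ l =
      exp (a * (Real.pi * I - l)) * exp l * entireStieltjes a (l + ζ) := by
  have hc : IsAnalyticContinuation (firstHyperterminantIntegral a) firstPrincipalBranch univ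
      (fun p => exp (a * (Real.pi * I - p.2)) * exp p.2 * entireStieltjes a (p.2 + p.1)) := by
    refine ⟨isOpen_lt (f := fun p : ℂ × ℂ => |(p.2 + p.1).im|) (by fun_prop) continuous_const,
      ⟨0, by simpa [firstPrincipalBranch] using Real.pi_pos⟩, subset_univ _, isOpen_univ,
      isPreconnected_univ, ?_, fun p hp => ?_⟩
    · have := differentiable_entireStieltjes ha
      fun_prop
    · rw [firstHyperterminantIntegral_eq, entireStieltjes_eq ha hp]
  have hc' : IsAnalyticContinuation (firstHyperterminantIntegral a) firstPrincipalBranch univ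
      (fun p => firstHyperterminant a p.1 p.2) := Classical.epsilon_spec ⟨_, hc⟩
  exact ⟨hc', fun ζ l => hc'.unique hc (mem_univ (ζ, l))⟩

theorem isOpen_secondDomain : IsOpen secondDomain :=
  (isOpen_lt (f := fun p : ℂ × ℂ × ℂ => |(p.2.1 + p.1).im|) (by fun_prop) continuous_const).inter
    (isOpen_ratioDomain.preimage (f := fun p : ℂ × ℂ × ℂ => p.2.2 - p.2.1) (by fun_prop))

theorem isPreconnected_secondDomain : IsPreconnected secondDomain := by
  -- In the coordinates log(σ₀z), log σ₀, log(σ₁/σ₀) the domain is a product of connected sets.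
  have h : secondDomain = (fun q : ℂ × ℂ × ℂ => (q.1 - q.2.1, q.2.1, q.2.2 + q.2.1)) ''
      ({w : ℂ | |w.im - 0| < 3 * Real.pi / 2} ×ˢ (univ ×ˢ ratioDomain)) := by
    ext ⟨ζ, l₀, l₁⟩
    constructor
    · intro h
      exact ⟨(l₀ + ζ, l₀, l₁ - l₀), ⟨by simpa using h.1, mem_univ _, h.2⟩, by simp⟩
    · rintro ⟨⟨w, l, s⟩, ⟨h1, -, h2⟩, h3⟩
      simp only [Prod.mk.injEq] at h3
      obtain ⟨rfl, rfl, rfl⟩ := h3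
      exact ⟨by simpa using h1, by simpa using h2⟩
  rw [h]
  exact ((convex_strip 0 _).isPreconnected.prod
    (isPreconnected_univ.prod isPreconnected_ratioDomain)).image _ (by fun_prop)

theorem secondHyperterminant_isAnalyticContinuation {N₀ N₁ : ℂ} (hN₀ : -1 < N₀.re)
    (hN₁ : -1 < N₁.re) (hN : -1 < (N₀ + N₁).re) :
    IsAnalyticContinuation (secondHyperterminantIntegral N₀ N₁) secondPrincipalBranch secondDomain
      (fun p => secondHyperterminant N₀ N₁ p.1 p.2.1 p.2.2) ∧
    ∀ ζ l₀ l₁ : ℂ, (ζ, l₀, l₁) ∈ secondDomain → secondHyperterminant N₀ N₁ ζ l₀ l₁ =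
      exp (N₀ * (Real.pi * I - l₀)) * exp (N₁ * (Real.pi * I - l₁)) *
        scaledSecond N₀ N₁ (l₀ + ζ) (l₁ - l₀) := by
  have hpi := Real.pi_pos
  have hc : IsAnalyticContinuation (secondHyperterminantIntegral N₀ N₁) secondPrincipalBranch
      secondDomain (fun p => exp (N₀ * (Real.pi * I - p.2.1)) * exp (N₁ * (Real.pi * I - p.2.2)) *
        scaledSecond N₀ N₁ (p.2.1 + p.1) (p.2.2 - p.2.1)) := by
    refine ⟨?_, ⟨(0, 0, -1 + Real.pi * I), ⟨?_, ?_⟩, ?_, ?_, ?_⟩, fun p hp => hp.1,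
      isOpen_secondDomain, isPreconnected_secondDomain, fun p hp => ?_, fun p hp => ?_⟩
    · exact isOpen_secondDomain.inter
        ((isOpen_lt (f := fun p : ℂ × ℂ × ℂ => |(p.2.1 + p.1).im|) (by fun_prop)
          continuous_const).inter
        ((isOpen_lt (g := fun p : ℂ × ℂ × ℂ => (p.2.2 - p.2.1).im) continuous_const
          (by fun_prop)).inter
        (isOpen_lt (f := fun p : ℂ × ℂ × ℂ => (p.2.2 - p.2.1).im) (by fun_prop)
          continuous_const)))
    · simpa using hpi
    · exact re_neg_subset_ratioDomain (by simp)
    · simpa using hpi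
    · simpa using hpi
    · simp; linarith
    · have h1 : DifferentiableAt ℂ (fun p : ℂ × ℂ × ℂ =>
          scaledSecond N₀ N₁ (p.2.1 + p.1) (p.2.2 - p.2.1)) p :=
        (differentiableAt_scaledSecond hN₀ hN₁ hN (q := (p.2.1 + p.1, p.2.2 - p.2.1)) hp.2).comp p
          (f := fun p : ℂ × ℂ × ℂ => (p.2.1 + p.1, p.2.2 - p.2.1)) (by fun_prop)
      exact (by fun_prop : DifferentiableAt ℂ _ p).differentiableWithinAt
    · obtain ⟨h1, h2, h3, h4⟩ := hp
      rw [secondHyperterminantIntegral_eq, stieltjes_innerKernel_eq hN₀ hN₁ hN h1.2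
        (abs_lt.2 ⟨by linarith, by linarith⟩) h2]
  have hc' : IsAnalyticContinuation (secondHyperterminantIntegral N₀ N₁) secondPrincipalBranch
      secondDomain (fun p => secondHyperterminant N₀ N₁ p.1 p.2.1 p.2.2) :=
    Classical.epsilon_spec ⟨_, hc⟩
  exact ⟨hc', fun ζ l₀ l₁ h => hc'.unique hc h⟩

/-! ### The tail integral -/

/-- The change of variable ξ = log(σ₀t); the factor `exp τ` is dt/dτ and absorbs the extra power
t⁻¹. -/
theorem tailIntegrand_mul_exp {N₀ : ℂ} (hN₀ : -1 < N₀.re) (N₁ l₀ l₁ τ : ℂ) :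
    tailIntegrand N₀ N₁ l₀ l₁ τ * exp τ =
      exp ((N₀ + 1) * (Real.pi * I - l₀) + l₀ + (N₀ + N₁) * l₀) *
        scaledTail (N₀ + N₁) (N₀ + 1) (l₁ - l₀) (τ + l₀) := by
  have e : exp (-(exp l₀ + exp l₁) * exp τ) * exp ((-N₀ - N₁ - 1) * τ) * exp τ =
      exp ((N₀ + N₁) * l₀) *
        exp (-((1 + exp (l₁ - l₀)) * exp (τ + l₀) + (N₀ + N₁) * (τ + l₀))) := by
    rw [← exp_add, ← exp_add, ← exp_add, exp_add τ, exp_sub]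
    congr 1
    have := exp_ne_zero l₀
    field_simp
    ring
  rw [tailIntegrand, (firstHyperterminant_isAnalyticContinuation (re_add_one_pos hN₀)).2,
    scaledTail, exp_add, exp_add, add_comm l₀ τ]
  linear_combination (exp ((N₀ + 1) * (Real.pi * I - l₀)) * exp l₀ *
    entireStieltjes (N₀ + 1) (τ + l₀)) * e

theorem add_mul_I_add (x ω : ℝ) (l : ℂ) :
    (x : ℂ) + ω * I + l = ((x + l.re : ℝ) : ℂ) + ((ω + l.im : ℝ) : ℂ) * I := by
  conv_lhs => rw [← re_add_im l]
  push_cast; ring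

theorem measurePreserving_add_restrict (x₀ d : ℝ) :
    MeasurePreserving (fun x : ℝ => x + d) (volume.restrict (Ioi x₀))
      (volume.restrict (Ioi (x₀ + d))) := by
  have h := (measurePreserving_add_right volume d).restrict_preimage (measurableSet_Ioi (a := x₀ + d))
  simpa using h

theorem integrableOn_logRayIntegrand {N₀ : ℂ} (hN₀ : -1 < N₀.re) (N₁ : ℂ) {l₀ l₁ : ℂ}
    (hl : l₁ - l₀ ∈ ratioDomain) {ω : ℝ}
    (hω : |ω + l₀.im + (1 + exp (l₁ - l₀)).arg| < Real.pi / 2) (x₀ : ℝ) :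
    IntegrableOn (logRayIntegrand (tailIntegrand N₀ N₁ l₀ l₁) ω) (Ioi x₀) := by
  have h := (integrableOn_scaledTail (n := N₀ + N₁) (re_add_one_pos hN₀) hl hω (x₀ + l₀.re))
  have h2 := (measurePreserving_add_restrict x₀ l₀.re).integrable_comp_of_integrable h
  refine (h2.const_mul (exp ((N₀ + 1) * (Real.pi * I - l₀) + l₀ + (N₀ + N₁) * l₀))).congr
    (Eventually.of_forall fun x => ?_)
  simp only [logRayIntegrand, tailIntegrand_mul_exp hN₀, add_mul_I_add, Function.comp]

theorem integralToInfinity_tailIntegrand {N₀ : ℂ} (hN₀ : -1 < N₀.re) (N₁ ζ l₀ l₁ : ℂ) (ω : ℝ) :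
    integralToInfinity (tailIntegrand N₀ N₁ l₀ l₁) ζ ω =
      exp ((N₀ + 1) * (Real.pi * I - l₀) + l₀ + (N₀ + N₁) * l₀) *
        angularIntegral (scaledTail (N₀ + N₁) (N₀ + 1) (l₁ - l₀)) (l₀ + ζ) (ω + l₀.im) := by
  have e1 : ∀ x θ : ℝ, tailIntegrand N₀ N₁ l₀ l₁ (x + θ * I) * (I * exp (x + θ * I)) =
      exp ((N₀ + 1) * (Real.pi * I - l₀) + l₀ + (N₀ + N₁) * l₀) *
        (scaledTail (N₀ + N₁) (N₀ + 1) (l₁ - l₀)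
          (((x + l₀.re : ℝ) : ℂ) + ((θ + l₀.im : ℝ) : ℂ) * I) * I) := fun x θ => by
    rw [← add_mul_I_add]
    linear_combination I * tailIntegrand_mul_exp hN₀ N₁ l₀ l₁ (x + θ * I)
  have e2 : ∀ x : ℝ, logRayIntegrand (tailIntegrand N₀ N₁ l₀ l₁) ω x =
      exp ((N₀ + 1) * (Real.pi * I - l₀) + l₀ + (N₀ + N₁) * l₀) *
        scaledTail (N₀ + N₁) (N₀ + 1) (l₁ - l₀)
          (((x + l₀.re : ℝ) : ℂ) + ((ω + l₀.im : ℝ) : ℂ) * I) := fun x => by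
    rw [logRayIntegrand, tailIntegrand_mul_exp hN₀, add_mul_I_add]
  have e3 : l₀.re + ζ.re = ζ.re + l₀.re := add_comm _ _
  have e4 : l₀.im + ζ.im = ζ.im + l₀.im := add_comm _ _
  simp only [integralToInfinity, angularIntegral, e1, e2, add_re, add_im, e3, e4]
  rw [intervalIntegral.integral_const_mul, integral_const_mul, mul_add,
    intervalIntegral.integral_comp_add_right (fun θ : ℝ => scaledTail (N₀ + N₁) (N₀ + 1) (l₁ - l₀)
      (((ζ.re + l₀.re : ℝ) : ℂ) + (θ : ℂ) * I) * I),
    ← (measurePreserving_add_restrict ζ.re l₀.re).integral_comp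
      (measurableEmbedding_addRight l₀.re)]

/-! ### The representation formula -/

/-- New integral representation of the second hyperterminant, with `z = exp ζ`, `σ₀ = exp l₀`,
`σ₁ = exp l₁`. -/
theorem mainTheorem8 (N₀ N₁ : ℂ) (hN₀ : -1 < N₀.re) (hN₁ : -1 < N₁.re)
    (hN : -1 < (N₀ + N₁).re) :
    -- the functions in the formula exist as analytic continuations
    IsAnalyticContinuation (firstHyperterminantIntegral (N₀ + 1)) firstPrincipalBranch univ
      (fun p => firstHyperterminant (N₀ + 1) p.1 p.2) ∧
    IsAnalyticContinuation (firstHyperterminantIntegral (N₀ + N₁ + 1)) firstPrincipalBranch univ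
      (fun p => firstHyperterminant (N₀ + N₁ + 1) p.1 p.2) ∧
    IsAnalyticContinuation
      (fun l => ordinaryHypergeometric 1 (N₀ + 1) (N₀ + N₁ + 2) (1 + exp l)) hypergeometricBase
      ratioDomain (hypergeometricOneAdd 1 (N₀ + 1) (N₀ + N₁ + 2)) ∧
    IsAnalyticContinuation (secondHyperterminantIntegral N₀ N₁) secondPrincipalBranch secondDomain
      (fun p => secondHyperterminant N₀ N₁ p.1 p.2.1 p.2.2) ∧
    -- the representation, for every direction in which the path of integration may go to infinity
    ∀ ζ l₀ l₁ : ℂ, (ζ, l₀, l₁) ∈ secondDomain →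
      ∀ ω : ℝ, |ω + (logSum l₀ l₁).im| < Real.pi / 2 →
        IntegrableOn (logRayIntegrand (tailIntegrand N₀ N₁ l₀ l₁) ω) (Ioi ζ.re) ∧
        secondHyperterminant N₀ N₁ ζ l₀ l₁ =
          -(exp ((N₀ + N₁ + 1) * logSum l₀ l₁) * exp ((-N₀ - 1) * l₀) * exp (-N₁ * l₁)) *
              (Gamma (N₀ + 1) * Gamma (N₁ + 1) / Gamma (N₀ + N₁ + 2)) *
              hypergeometricOneAdd 1 (N₀ + 1) (N₀ + N₁ + 2) (l₁ - l₀) *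
              firstHyperterminant (N₀ + N₁ + 1) ζ (logSum l₀ l₁)
            - Gamma (N₁ + 1) * exp (-N₁ * (l₁ - Real.pi * I)) *
              exp ((exp l₀ + exp l₁) * exp ζ) * exp ((N₀ + N₁) * ζ) *
              integralToInfinity (tailIntegrand N₀ N₁ l₀ l₁) ζ ω := by
  have hF := firstHyperterminant_isAnalyticContinuation (re_add_one_pos hN)
  have hS := secondHyperterminant_isAnalyticContinuation hN₀ hN₁ hN
  refine ⟨(firstHyperterminant_isAnalyticContinuation (re_add_one_pos hN₀)).1, hF.1,
    (hypergeometric_isAnalyticContinuation hN₀ hN₁ hN).1, hS.1, fun ζ l₀ l₁ hD ω hω => ?_⟩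
  have hl : l₁ - l₀ ∈ ratioDomain := hD.2
  have hω' : |ω + l₀.im + (1 + exp (l₁ - l₀)).arg| < Real.pi / 2 := by
    simpa [logSum, log_im, add_assoc] using hω
  refine ⟨integrableOn_logRayIntegrand hN₀ N₁ hl hω' _, ?_⟩
  rw [hS.2 ζ l₀ l₁ hD, hF.2, integralToInfinity_tailIntegrand hN₀,
    -- The prescribed direction is replaced by the steepest one, in terms of which `scaledSecond` is
    -- written.
    angularIntegral_scaledTail_eq (re_add_one_pos hN₀) hl hω' (abs_neg_arg_add_arg _),
    ← tailIntegral, scaledSecond]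
  have hy := exp_log (one_add_exp_ne_zero hl)
  have e0 : logSum l₀ l₁ + ζ = l₀ + ζ + log (1 + exp (l₁ - l₀)) := by rw [logSum]; ring
  have hpi : ∀ s : ℂ, exp (s + Real.pi * I) = -exp s := fun s => by
    rw [exp_add, exp_pi_mul_I, mul_neg_one]
  -- The exponents on the left exceed those on the right by exactly πi; this is the minus sign of
  -- the first term, and in `e2` that of the second.
  have e1 : exp ((N₀ + N₁ + 1) * logSum l₀ l₁) * exp ((-N₀ - 1) * l₀) * exp (-N₁ * l₁) *
      (exp ((N₀ + N₁ + 1) * (Real.pi * I - logSum l₀ l₁)) * exp (logSum l₀ l₁)) =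
      -(exp (N₀ * (Real.pi * I - l₀)) * exp (N₁ * (Real.pi * I - l₁)) *
        (1 + exp (l₁ - l₀))) := by
    rw [← hy, ← exp_add, ← exp_add, ← exp_add, ← exp_add, ← exp_add, ← exp_add, ← hpi]
    congr 1
    rw [logSum]
    ring
  have e2 : exp (-N₁ * (l₁ - Real.pi * I)) * exp ((exp l₀ + exp l₁) * exp ζ) *
      exp ((N₀ + N₁) * ζ) * exp ((N₀ + 1) * (Real.pi * I - l₀) + l₀ + (N₀ + N₁) * l₀) =
      -(exp (N₀ * (Real.pi * I - l₀)) * exp (N₁ * (Real.pi * I - l₁)) *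
        exp ((1 + exp (l₁ - l₀)) * exp (l₀ + ζ) + (N₀ + N₁) * (l₀ + ζ))) := by
    have : (1 + exp (l₁ - l₀)) * exp (l₀ + ζ) = (exp l₀ + exp l₁) * exp ζ := by
      have := exp_ne_zero l₀
      rw [exp_add, exp_sub]; field_simp
    rw [this, ← exp_add, ← exp_add, ← exp_add, ← exp_add, ← exp_add, ← hpi]
    congr 1
    ring
  rw [e0]
  linear_combination (Gamma (N₀ + 1) * Gamma (N₁ + 1) / Gamma (N₀ + N₁ + 2) *
      hypergeometricOneAdd 1 (N₀ + 1) (N₀ + N₁ + 2) (l₁ - l₀) *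
      entireStieltjes (N₀ + N₁ + 1) (l₀ + ζ + log (1 + exp (l₁ - l₀)))) * e1 +
    (Gamma (N₁ + 1) * tailIntegral (N₀ + N₁) (N₀ + 1) (l₀ + ζ) (l₁ - l₀)) * e2
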